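/- For permutations of $[n]=\{1,\dots,n\}$ written in one-line notation, say that $\pi$ contains $\rho$ (of size $k$) as a pattern if there are indices $i_1<\cdots<i_k$ such that $\pi_{i_1}\cdots\pi_{i_k}$ is in the same relative order as $\rho_1\cdots\rho_k$; otherwise $\pi$ avoids $\rho$. For integers $a\ge 1$ and $b\ge 0$ with $a+b\ge 2$, let the partial shuffle $\Pi(a,b)$ be the set of all permutations of size $a+b$ obtained by writing the elements of $[a+b]\setminus\{a\}$ in increasing order and inserting $a$ in any position, except for the position that gives the increasing permutation. Let $\delta_m$ be the decreasing permutation of size $m$, and let $\mathrm{Av}_n(\Pi(a,b),\delta_m)$ be the set of permutations of size $n$ that avoid $\delta_m$ and every element of $\Pi(a,b)$. Theorem. Let $a\ge 1$, $b\ge 0$ and $m\ge 2$ be integers with $a+b\ge 2$. Then there is a polynomial $p\in\mathbb{Q}[x]$ (depending on $a,b,m$), nonzero and of degree exactly $(a+b-2)(m-2)$, such that $\#\mathrm{Av}_n(\Pi(a,b),\delta_m)=p(n)$ for all sufficiently large $n$. -/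

import Mathlib

/-! Permutations of size `n` are elements of `Equiv.Perm (Fin n)`, so positions and values are
numbered from `0`: the value called `v` in one-line notation on `{1, …, n}` is `v - 1` here. -/

namespace PermPattern

/-- `π` contains `ρ` as a pattern: there are positions `f 0 < f 1 < ⋯ < f (k-1)` of `π` at which
the entries of `π` are in the same relative order as the entries of `ρ`. -/
def Contains {n k : ℕ} (π : Equiv.Perm (Fin n)) (ρ : Equiv.Perm (Fin k)) : Prop :=
  ∃ f : Fin k → Fin n, StrictMono f ∧ ∀ i j : Fin k, π (f i) < π (f j) ↔ ρ i < ρ j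

/-- A permutation of arbitrary finite size. -/
abbrev SizedPerm : Type := Σ k : ℕ, Equiv.Perm (Fin k)

/-- The set of permutations of size `n` that avoid every pattern in `B`. -/
def Av (n : ℕ) (B : Set SizedPerm) : Set (Equiv.Perm (Fin n)) :=
  {π | ∀ ρ ∈ B, ¬ Contains π ρ.2}

/-- The partial shuffle `Π(a, b)`: the permutations of size `a + b` in which the values other than
`a` appear in increasing order from left to right (so `a` may be at any position), except for the
increasing permutation. -/
def partialShuffle (a b : ℕ) : Set SizedPerm :=
  Sigma.mk (a + b) '' {ρ : Equiv.Perm (Fin (a + b)) |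
    (∀ i j : Fin (a + b), (ρ i : ℕ) + 1 ≠ a → (ρ j : ℕ) + 1 ≠ a → i < j → ρ i < ρ j) ∧ ρ ≠ 1}

/-- The decreasing permutation `δ_m` of size `m`. -/
def decreasing (m : ℕ) : SizedPerm := ⟨m, Fin.revPerm⟩

end PermPattern

/-!
The class consists of the permutations without a decreasing subsequence of length `m` in which no
entry is displaced to the left (`NoLeftShift`) or to the right (`NoRightShift`) of its place between
an increasing sequence of `a - 1` smaller entries and an increasing sequence of `b` larger ones.

A permutation is cut into its *runs*, the maximal sequences of adjacent entries that are consecutive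
integers in increasing order; it is the inflation, by these runs, of a permutation `σ` without such
adjacencies (`exists_runFree_isInflation`), and `σ` and the run lengths are determined by it
(`IsInflation.data_unique`). By the Erdős–Szekeres theorem the number of runs of a permutation in
the class is bounded (`card_breaks_le`): otherwise there would be a long increasing sequence of
entries with a break after each, such that the entries after the breaks are increasing as well.
As the forbidden patterns have size at most `c = a + b + m`, membership in the class depends only on
`σ` and on the run lengths truncated at `c` (`IsInflation.contains_of_min_le`). So the class is
counted by a finite sum, over `σ` and the truncated lengths, of the numbers of vectors of run
lengths with sum `n` and the given truncation; if `j` of the runs are long, that is, truncated to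
`c`, this number is a polynomial in `n` of degree `j - 1` with positive leading coefficient for
large `n`, and it is `0` if `j = 0` (`eval_countPoly`).

It remains to see that the largest number of long runs is `(a + b - 2) * (m - 2) + 1`.

* Upper bound (`card_longRunEnds_le`). Between any two consecutive long runs there is a separator
  (`exists_separator`): the last entry of the first run if the second run is below the first, and
  otherwise the entry after it, which is above the second run or below the first. An increasing
  sequence of `a + b - 1` separators would break one of the two rules, and a decreasing sequence of
  `m - 1` separators could be extended by an entry of a run to one of length `m`. Hence there are at
  most `(a + b - 2) * (m - 2)` separators, again by Erdős–Szekeres.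
* Lower bound (`exists_perm_with_long_runs`). If `a ≥ 2` and `b ≥ 1`, take `m - 1` increasing blocks,
  each below and to the right of the one before. Cut the first block by `(a - 2) * (m - 2)` single
  entries below everything else and the last one by `(b - 1) * (m - 2)` single entries above
  everything else; the former have no increasing subsequence longer than `a - 2`, the latter none
  longer than `b - 1`, and neither has a decreasing one longer than `m - 2`. If `a = 1` or `b = 0`,
  cut a single block only by the entries of the second or of the first kind, respectively.
-/

namespace PermPattern

/-! ### Ranking keys and monotone subsets -/

/-- Ranking the values of an injective key gives a permutation in the same relative order. -/
theorem exists_perm_of_key {n : ℕ} {α : Type*} [LinearOrder α] (key : Fin n → α)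
    (hkey : Function.Injective key) :
    ∃ π : Equiv.Perm (Fin n), ∀ i j, π i < π j ↔ key i < key j := by
  have hs : StrictMono (key ∘ Tuple.sort key) :=
    (Tuple.monotone_sort key).strictMono_of_injective (hkey.comp (Tuple.sort key).injective)
  refine ⟨(Tuple.sort key)⁻¹, fun i j => ?_⟩
  rw [← hs.lt_iff_lt]
  simp

/-- The Erdős–Szekeres theorem for an injective function on a finite set. -/
theorem exists_strictMonoOn_or_strictAntiOn {α β : Type*} [LinearOrder α] [LinearOrder β]
    (f : α → β) (A B : ℕ) (s : Finset α) (hf : Set.InjOn f s) (h : A * B < s.card) :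
    (∃ t ⊆ s, t.card = A + 1 ∧ StrictMonoOn f t) ∨
      (∃ t ⊆ s, t.card = B + 1 ∧ StrictAntiOn f t) := by
  classical
  induction A generalizing s with
  | zero =>
    obtain ⟨x, hx⟩ : s.Nonempty := Finset.card_pos.mp (by omega)
    exact Or.inl ⟨{x}, by simpa using hx, by simp, by simp [StrictMonoOn]⟩
  | succ A ih =>
    -- split off the elements that are minimal for the order `x < y ∧ f x < f y`
    set s' := s.filter fun x => ∃ y ∈ s, y < x ∧ f y < f x with hs'
    have hcard : s'.card + (s.filter fun x => ¬ ∃ y ∈ s, y < x ∧ f y < f x).card = s.card :=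
      Finset.card_filter_add_card_filter_not _
    by_cases hB : B < (s.filter fun x => ¬ ∃ y ∈ s, y < x ∧ f y < f x).card
    · right
      obtain ⟨t, ht, htc⟩ := Finset.exists_subset_card_eq (Nat.succ_le_of_lt hB)
      refine ⟨t, ht.trans (Finset.filter_subset _ _), htc, fun x hx y hy hxy => ?_⟩
      have hx' := Finset.mem_filter.mp (ht hx)
      have hy' := Finset.mem_filter.mp (ht hy)
      refine lt_of_le_of_ne (not_lt.mp fun hlt => hy'.2 ⟨x, hx'.1, hxy, hlt⟩) fun he => ?_
      exact hxy.ne' (hf hy'.1 hx'.1 he)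
    · have hsub : s' ⊆ s := Finset.filter_subset _ _
      have : A * B < s'.card := by
        rw [Nat.succ_mul] at h
        omega
      rcases ih s' (hf.mono hsub) this with ⟨t, ht, htc, hmono⟩ | ⟨t, ht, htc, hanti⟩
      · left
        have hne : t.Nonempty := Finset.card_pos.mp (by omega)
        have hmin := t.min'_mem hne
        obtain ⟨-, y, hy, hylt, hfy⟩ := Finset.mem_filter.mp (ht hmin)
        have hlt : ∀ x ∈ t, y < x := fun x hx => hylt.trans_le (t.min'_le x hx)
        have hflt : ∀ x ∈ t, f y < f x := fun x hx =>
          hfy.trans_le (hmono.monotoneOn hmin hx (t.min'_le x hx))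
        refine ⟨insert y t, Finset.insert_subset hy (ht.trans hsub), ?_, ?_⟩
        · rw [Finset.card_insert_of_notMem fun hyt => (hlt y hyt).false, htc]
        · intro u hu v hv huv
          rcases Finset.mem_insert.mp hu with rfl | hu' <;>
            rcases Finset.mem_insert.mp hv with rfl | hv'
          · exact absurd huv (lt_irrefl _)
          · exact hflt v hv'
          · exact absurd (hlt u hu') huv.not_gt
          · exact hmono hu' hv' huv
      · exact Or.inr ⟨t, ht.trans hsub, htc, hanti⟩

/-! ### Chains below and above a point -/

/-- `ChainBelow π r i v`: some `r` entries of `π` at positions less than `i` and with values less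
than `v` form an increasing subsequence. -/
def ChainBelow {n : ℕ} (π : Equiv.Perm (Fin n)) : ℕ → ℕ → ℕ → Prop
  | 0, _, _ => True
  | r + 1, i, v => ∃ p : Fin n, (p : ℕ) < i ∧ (π p : ℕ) < v ∧ ChainBelow π r p (π p)

/-- `ChainAbove π r i v`: some `r` entries of `π` at positions greater than `i` and with values
greater than `v` form an increasing subsequence. -/
def ChainAbove {n : ℕ} (π : Equiv.Perm (Fin n)) : ℕ → ℕ → ℕ → Prop
  | 0, _, _ => True
  | r + 1, i, v => ∃ p : Fin n, i < (p : ℕ) ∧ v < (π p : ℕ) ∧ ChainAbove π r p (π p)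

section Chains

variable {n : ℕ} {π : Equiv.Perm (Fin n)}

theorem ChainBelow.mono {r s i i' v v' : ℕ} (h : ChainBelow π r i v) (hs : s ≤ r) (hi : i ≤ i')
    (hv : v ≤ v') : ChainBelow π s i' v' := by
  induction s generalizing r i i' v v' with
  | zero => trivial
  | succ s ih =>
    obtain ⟨r, rfl⟩ : ∃ r', r = r' + 1 := ⟨r - 1, by omega⟩
    obtain ⟨p, hp, hpv, hr⟩ := h
    exact ⟨p, by omega, by omega, ih hr (by omega) le_rfl le_rfl⟩

theorem ChainAbove.mono {r s i i' v v' : ℕ} (h : ChainAbove π r i v) (hs : s ≤ r) (hi : i' ≤ i)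
    (hv : v' ≤ v) : ChainAbove π s i' v' := by
  induction s generalizing r i i' v v' with
  | zero => trivial
  | succ s ih =>
    obtain ⟨r, rfl⟩ : ∃ r', r = r' + 1 := ⟨r - 1, by omega⟩
    obtain ⟨p, hp, hpv, hr⟩ := h
    exact ⟨p, by omega, by omega, ih hr (by omega) le_rfl le_rfl⟩

theorem ChainBelow.exists_finset {r i v : ℕ} (h : ChainBelow π r i v) :
    ∃ S : Finset (Fin n), S.card = r ∧ StrictMonoOn π S ∧
      ∀ p ∈ S, (p : ℕ) < i ∧ (π p : ℕ) < v := by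
  induction r generalizing i v with
  | zero => exact ⟨∅, by simp [StrictMonoOn]⟩
  | succ r ih =>
    obtain ⟨p, hp, hpv, hr⟩ := h
    obtain ⟨S, hS, hmono, hlt⟩ := ih hr
    refine ⟨insert p S, ?_, ?_, ?_⟩
    · rw [Finset.card_insert_of_notMem fun hpS => (hlt p hpS).1.false, hS]
    · intro x hx y hy hxy
      rcases Finset.mem_insert.mp hx with rfl | hx' <;>
        rcases Finset.mem_insert.mp hy with rfl | hy'
      · exact absurd hxy (lt_irrefl _)
      · exact absurd (hlt y hy').1 (not_lt.mpr hxy.le)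
      · exact (hlt x hx').2
      · exact hmono hx' hy' hxy
    · intro x hx
      rcases Finset.mem_insert.mp hx with rfl | hx
      · exact ⟨hp, hpv⟩
      · exact ⟨(hlt x hx).1.trans hp, (hlt x hx).2.trans hpv⟩

theorem ChainAbove.exists_finset {r i v : ℕ} (h : ChainAbove π r i v) :
    ∃ S : Finset (Fin n), S.card = r ∧ StrictMonoOn π S ∧
      ∀ p ∈ S, i < (p : ℕ) ∧ v < (π p : ℕ) := by
  induction r generalizing i v with
  | zero => exact ⟨∅, by simp [StrictMonoOn]⟩
  | succ r ih =>
    obtain ⟨p, hp, hpv, hr⟩ := h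
    obtain ⟨S, hS, hmono, hlt⟩ := ih hr
    refine ⟨insert p S, ?_, ?_, ?_⟩
    · rw [Finset.card_insert_of_notMem fun hpS => (hlt p hpS).1.false, hS]
    · intro x hx y hy hxy
      rcases Finset.mem_insert.mp hx with rfl | hx' <;>
        rcases Finset.mem_insert.mp hy with rfl | hy'
      · exact absurd hxy (lt_irrefl _)
      · exact (hlt y hy').2
      · exact absurd (hlt x hx').1 (not_lt.mpr hxy.le)
      · exact hmono hx' hy' hxy
    · intro x hx
      rcases Finset.mem_insert.mp hx with rfl | hx
      · exact ⟨hp, hpv⟩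
      · exact ⟨hp.trans (hlt x hx).1, hpv.trans (hlt x hx).2⟩

/-- The entries of an increasing sequence before its `j`-th entry form a chain below it. -/
theorem chainBelow_of_strictMono {g : ℕ → Fin n} {N : ℕ}
    (hg : ∀ i j, i < j → j < N → g i < g j ∧ π (g i) < π (g j)) {j r : ℕ} (hr : r ≤ j)
    (hj : j < N) : ChainBelow π r (g j) (π (g j)) := by
  induction r generalizing j with
  | zero => trivial
  | succ r ih =>
    have := hg (j - 1) j (by omega) hj
    exact ⟨g (j - 1), this.1, this.2, ih (by omega) (by omega)⟩

/-- The entries of an increasing sequence after its `j`-th entry form a chain above it. -/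
theorem chainAbove_of_strictMono {g : ℕ → Fin n} {N : ℕ}
    (hg : ∀ i j, i < j → j < N → g i < g j ∧ π (g i) < π (g j)) {j r : ℕ} (hr : j + r < N) :
    ChainAbove π r (g j) (π (g j)) := by
  induction r generalizing j with
  | zero => trivial
  | succ r ih =>
    have := hg j (j + 1) (by omega) (by omega)
    exact ⟨g (j + 1), this.1, this.2, ih (by omega)⟩

end Chains

/-! ### Avoidance in terms of chains -/

section Avoidance

variable {n : ℕ} {π : Equiv.Perm (Fin n)}

/-- No entry `z` of `π` plays the role of `a` in an element of `Π(a, b)` in which `a` stands to the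
left of `a - 1`, the role of which is played by `p`. -/
def NoLeftShift (a b : ℕ) (π : Equiv.Perm (Fin n)) : Prop :=
  2 ≤ a → ∀ z p : Fin n, z < p → π p < π z → ChainBelow π (a - 2) p (π p) →
    ChainAbove π b p (π z) → False

/-- No entry `z` of `π` plays the role of `a` in an element of `Π(a, b)` in which `a` stands to the
right of `a + 1`, the role of which is played by `q`. -/
def NoRightShift (a b : ℕ) (π : Equiv.Perm (Fin n)) : Prop :=
  1 ≤ b → ∀ z q : Fin n, q < z → π z < π q → ChainAbove π (b - 1) q (π q) →
    ChainBelow π (a - 1) q (π z) → False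

/-- The longest decreasing subsequence of `π` is shorter than `m`. -/
def NoLongDecreasing (m : ℕ) (π : Equiv.Perm (Fin n)) : Prop :=
  ∀ S : Finset (Fin n), StrictAntiOn π S → S.card < m

/-- An increasing set of positions together with one more entry that is out of place forms an
element of the partial shuffle. -/
theorem exists_contains_of_finset {a b : ℕ} (ha : 1 ≤ a) (T : Finset (Fin n))
    (hT : T.card = a + b) (z : Fin n) (hz : z ∈ T)
    (hmono : ∀ x ∈ T, ∀ y ∈ T, x ≠ z → y ≠ z → x < y → π x < π y)
    (hbelow : (T.filter fun p => π p < π z).card = a - 1)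
    (hinv : ∃ x ∈ T, ∃ y ∈ T, x < y ∧ π y < π x) :
    ∃ ρ ∈ partialShuffle a b, Contains π ρ.2 := by
  set f := T.orderEmbOfFin hT with hf
  obtain ⟨ρ, hρ⟩ := exists_perm_of_key (fun i => π (f i)) (π.injective.comp f.injective)
  have hfT : ∀ i, f i ∈ T := T.orderEmbOfFin_mem hT
  have hsurj : ∀ x ∈ T, ∃ i, f i = x := fun x hx => by
    have : x ∈ Set.range f := by rw [hf, Finset.range_orderEmbOfFin]; exact hx
    exact this
  obtain ⟨i₀, hi₀⟩ := hsurj z hz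
  have hval : (ρ i₀ : ℕ) = a - 1 := by
    rw [← hbelow, ← Fin.card_Iio (ρ i₀)]
    refine Finset.card_bij (fun v _ => f (ρ.symm v)) ?_ ?_ ?_
    · intro v hv
      rw [Finset.mem_filter]
      refine ⟨hfT _, ?_⟩
      rw [← hi₀]
      exact (hρ _ _).mp (by simpa using hv)
    · intro v _ w _ h
      exact ρ.symm.injective (f.injective h)
    · intro x hx
      obtain ⟨hxT, hxz⟩ := Finset.mem_filter.mp hx
      obtain ⟨i, rfl⟩ := hsurj x hxT
      refine ⟨ρ i, ?_, by simp⟩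
      rw [Finset.mem_Iio, hρ, hi₀]
      exact hxz
  refine ⟨⟨a + b, ρ⟩, ⟨ρ, ⟨?_, ?_⟩, rfl⟩, f, f.strictMono, fun i j => (hρ i j).symm⟩
  · intro i j hi hj hij
    have hne : ∀ i : Fin (a + b), (ρ i : ℕ) + 1 ≠ a → f i ≠ z := by
      intro i hi h
      have : i = i₀ := f.injective (h.trans hi₀.symm)
      subst this
      omega
    exact (hρ i j).mpr (hmono _ (hfT i) _ (hfT j) (hne i hi) (hne j hj) (f.strictMono hij))
  · rintro rfl
    obtain ⟨x, hx, y, hy, hxy, hlt⟩ := hinv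
    obtain ⟨i, rfl⟩ := hsurj x hx
    obtain ⟨j, rfl⟩ := hsurj y hy
    have h1 := (hρ j i).mpr hlt
    have h2 := f.lt_iff_lt.mp hxy
    simp only [Equiv.Perm.coe_one, id_eq] at h1
    exact absurd h1 h2.not_gt

theorem noLeftShift_of_avoids {a b : ℕ}
    (h : ∀ ρ ∈ partialShuffle a b, ¬ Contains π ρ.2) : NoLeftShift a b π := by
  intro ha z p hzp hpz hbelow habove
  obtain ⟨S, hS, hSm, hSlt⟩ := hbelow.exists_finset
  obtain ⟨U, hU, hUm, hUlt⟩ := habove.exists_finset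
  have hpz' : (π p : ℕ) < π z := hpz
  have hzp' : (z : ℕ) < p := hzp
  have hpS : p ∉ S := fun hx => (hSlt p hx).1.false
  have hzS : z ∉ S := fun hx => by have := (hSlt z hx).2; omega
  have hpU : p ∉ U := fun hx => (hUlt p hx).1.false
  have hzU : z ∉ U := fun hx => (hUlt z hx).2.false
  have hdisj : Disjoint S U := Finset.disjoint_left.mpr fun x hx hx' => by
    have := (hSlt x hx).1; have := (hUlt x hx').1; omega
  have hzp_ne : z ≠ p := hzp.ne
  suffices hex : ∃ ρ ∈ partialShuffle a b, Contains π ρ.2 from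
    hex.elim fun ρ hc => h ρ hc.1 hc.2
  refine exists_contains_of_finset (π := π) (a := a) (b := b) (by omega)
    (insert z (insert p (S ∪ U))) ?_ z (Finset.mem_insert_self _ _) ?_ ?_
    ⟨z, by simp, p, by simp, hzp, hpz⟩
  · rw [Finset.card_insert_of_notMem (by simp [hzp_ne, hzS, hzU]),
      Finset.card_insert_of_notMem (by simp [hpS, hpU]), Finset.card_union_of_disjoint hdisj, hS, hU]
    omega
  · intro x hx y hy hxz hyz hxy
    have key : ∀ w ∈ insert z (insert p (S ∪ U)), w ≠ z → w = p ∨ w ∈ S ∨ w ∈ U := by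
      intro w hw hwz
      simp only [Finset.mem_insert, Finset.mem_union] at hw
      tauto
    have hxy' : (x : ℕ) < y := hxy
    change (π x : ℕ) < π y
    rcases key x hx hxz with rfl | hx' | hx' <;> rcases key y hy hyz with rfl | hy' | hy'
    · omega
    · have := hSlt y hy'; omega
    · have := hUlt y hy'; omega
    · exact (hSlt x hx').2
    · exact hSm hx' hy' hxy
    · have := hSlt x hx'; have := hUlt y hy'; omega
    · have := hUlt x hx'; omega
    · have := hUlt x hx'; have := hSlt y hy'; omega
    · exact hUm hx' hy' hxy
  · have : ((insert z (insert p (S ∪ U))).filter fun q => π q < π z) = insert p S := by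
      ext w
      simp only [Finset.mem_filter, Finset.mem_insert, Finset.mem_union]
      constructor
      · rintro ⟨rfl | rfl | hw | hw, hlt⟩
        · exact absurd hlt (lt_irrefl _)
        · exact Or.inl rfl
        · exact Or.inr hw
        · exact absurd (hUlt w hw).2 hlt.not_gt
      · rintro (rfl | hw)
        · exact ⟨by simp, hpz⟩
        · exact ⟨by simp [hw], (show (π w : ℕ) < π p from (hSlt w hw).2).trans hpz'⟩
    rw [this, Finset.card_insert_of_notMem hpS, hS]
    omega

theorem noRightShift_of_avoids {a b : ℕ} (ha : 1 ≤ a)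
    (h : ∀ ρ ∈ partialShuffle a b, ¬ Contains π ρ.2) : NoRightShift a b π := by
  intro hb z q hqz hzq habove hbelow
  obtain ⟨S, hS, hSm, hSlt⟩ := hbelow.exists_finset
  obtain ⟨U, hU, hUm, hUlt⟩ := habove.exists_finset
  have hzq' : (π z : ℕ) < π q := hzq
  have hqz' : (q : ℕ) < z := hqz
  have hqS : q ∉ S := fun hx => (hSlt q hx).1.false
  have hzS : z ∉ S := fun hx => (hSlt z hx).2.false
  have hqU : q ∉ U := fun hx => (hUlt q hx).1.false
  have hzU : z ∉ U := fun hx => by have := (hUlt z hx).2; omega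
  have hdisj : Disjoint S U := Finset.disjoint_left.mpr fun x hx hx' => by
    have := (hSlt x hx).1; have := (hUlt x hx').1; omega
  have hzq_ne : z ≠ q := hqz.ne'
  suffices hex : ∃ ρ ∈ partialShuffle a b, Contains π ρ.2 from
    hex.elim fun ρ hc => h ρ hc.1 hc.2
  refine exists_contains_of_finset (π := π) (a := a) (b := b) ha
    (insert z (insert q (S ∪ U))) ?_ z (Finset.mem_insert_self _ _) ?_ ?_
    ⟨q, by simp, z, by simp, hqz, hzq⟩
  · rw [Finset.card_insert_of_notMem (by simp [hzq_ne, hzS, hzU]),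
      Finset.card_insert_of_notMem (by simp [hqS, hqU]), Finset.card_union_of_disjoint hdisj, hS, hU]
    omega
  · intro x hx y hy hxz hyz hxy
    have key : ∀ w ∈ insert z (insert q (S ∪ U)), w ≠ z → w = q ∨ w ∈ S ∨ w ∈ U := by
      intro w hw hwz
      simp only [Finset.mem_insert, Finset.mem_union] at hw
      tauto
    have hxy' : (x : ℕ) < y := hxy
    change (π x : ℕ) < π y
    rcases key x hx hxz with rfl | hx' | hx' <;> rcases key y hy hyz with rfl | hy' | hy'
    · omega
    · have := hSlt y hy'; omega
    · have := hUlt y hy'; omega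
    · have := hSlt x hx'; omega
    · exact hSm hx' hy' hxy
    · have := hSlt x hx'; have := hUlt y hy'; omega
    · have := hUlt x hx'; omega
    · have := hUlt x hx'; have := hSlt y hy'; omega
    · exact hUm hx' hy' hxy
  · have : ((insert z (insert q (S ∪ U))).filter fun p => π p < π z) = S := by
      ext w
      simp only [Finset.mem_filter, Finset.mem_insert, Finset.mem_union]
      constructor
      · rintro ⟨rfl | rfl | hw | hw, hlt⟩
        · exact absurd hlt (lt_irrefl _)
        · exact absurd hlt hzq.not_gt
        · exact hw
        · have : (π q : ℕ) < π w := (hUlt w hw).2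
          exact absurd (hzq.trans (show π q < π w from this)) hlt.not_gt
      · intro hw
        exact ⟨by simp [hw], (hSlt w hw).2⟩
    rw [this, hS]

theorem strictMono_perm_eq_one {k : ℕ} {σ : Equiv.Perm (Fin k)} (h : StrictMono σ) : σ = 1 := by
  have := (h.range_inj strictMono_id).mp (by simp [σ.surjective.range_eq])
  ext i
  simp [this]

/-- An element of a partial shuffle contained in `π` violates one of the two rules, according to
the side to which the value `a` is displaced. -/
theorem avoids_of_noShift {a b : ℕ} (ha : 1 ≤ a) (hL : NoLeftShift a b π)
    (hR : NoRightShift a b π) : ∀ ρ ∈ partialShuffle a b, ¬ Contains π ρ.2 := by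
  rintro _ ⟨ρ, ⟨hρ, hne⟩, rfl⟩ ⟨f, hf, hord⟩
  dsimp only at f hf hord
  -- `h v` is the position of the entry of `π` that plays the role of the value `v + 1`
  let h : Fin (a + b) → Fin n := fun v => f (ρ.symm v)
  have hh : ∀ v w, π (h v) < π (h w) ↔ v < w := fun v w => by
    simp only [h, hord, Equiv.apply_symm_apply]
  have hpos : ∀ v w : Fin (a + b), (v : ℕ) + 1 ≠ a → (w : ℕ) + 1 ≠ a → v < w →
      ρ.symm v < ρ.symm w := by
    intro v w hv hw hvw
    by_contra hle
    rcases (not_lt.mp hle).lt_or_eq with hlt | heq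
    · have := hρ (ρ.symm w) (ρ.symm v) (by simpa using hw) (by simpa using hv) hlt
      simp only [Equiv.apply_symm_apply] at this
      exact absurd this hvw.not_gt
    · exact hvw.ne' (ρ.symm.injective heq)
  have below : ∀ (r : ℕ) (v : Fin (a + b)), r ≤ v → (v : ℕ) + 1 < a →
      ChainBelow π r (h v) (π (h v)) := by
    intro r
    induction r with
    | zero => intros; trivial
    | succ r ih =>
      intro v hv hva
      let u : Fin (a + b) := ⟨v - 1, by omega⟩
      have huv : u < v := Fin.lt_def.mpr (by simp only [u]; omega)
      exact ⟨h u, hf (hpos u v (by simp only [u]; omega) (by omega) huv), (hh u v).mpr huv,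
        ih u (by simp only [u]; omega) (by simp only [u]; omega)⟩
  have above : ∀ (r : ℕ) (v : Fin (a + b)), v + r < a + b → a ≤ v →
      ChainAbove π r (h v) (π (h v)) := by
    intro r
    induction r with
    | zero => intros; trivial
    | succ r ih =>
      intro v hv hva
      let u : Fin (a + b) := ⟨v + 1, by omega⟩
      have huv : v < u := Fin.lt_def.mpr (by simp only [u]; omega)
      exact ⟨h u, hf (hpos v u (by omega) (by simp only [u]; omega) huv), (hh v u).mpr huv,
        ih u (by simp only [u]; omega) (by simp only [u]; omega)⟩
  let z : Fin (a + b) := ⟨a - 1, by omega⟩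
  -- chains of `r + 1` values starting or ending next to the value `a`
  have above' : ∀ (r : ℕ) (i : Fin n), a + r ≤ a + b →
      (∀ v : Fin (a + b), a ≤ v → (i : ℕ) < h v) → ChainAbove π r i (π (h z)) := by
    intro r i hr hi
    rcases r with _ | r
    · trivial
    · let u : Fin (a + b) := ⟨a, by omega⟩
      exact ⟨h u, hi u le_rfl, (hh z u).mpr (Fin.lt_def.mpr (by simp only [z, u]; omega)),
        above r u (by simp only [u]; omega) le_rfl⟩
  have below' : ∀ (r : ℕ) (i : Fin n), r + 1 ≤ a →
      (∀ v : Fin (a + b), (v : ℕ) + 1 < a → (h v : ℕ) < i) → ChainBelow π r i (π (h z)) := by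
    intro r i hr hi
    rcases r with _ | r
    · trivial
    · let u : Fin (a + b) := ⟨a - 2, by omega⟩
      exact ⟨h u, hi u (by simp only [u]; omega),
        (hh u z).mpr (Fin.lt_def.mpr (by simp only [z, u]; omega)),
        below r u (by simp only [u]; omega) (by simp only [u]; omega)⟩
  apply hne
  suffices hs : StrictMono ρ.symm by
    have := strictMono_perm_eq_one hs
    ext i
    have h1 := ρ.symm_apply_apply i
    rw [this] at h1
    simpa using congrArg Fin.val h1
  by_contra hs
  obtain ⟨v, w, hvw, hle⟩ : ∃ v w, v < w ∧ ρ.symm w < ρ.symm v := by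
    simp only [StrictMono, not_forall, not_lt] at hs
    obtain ⟨v, w, hvw, hle⟩ := hs
    exact ⟨v, w, hvw, hle.lt_of_ne fun he => hvw.ne' (ρ.symm.injective he)⟩
  have hvw' : (v : ℕ) < w := hvw
  by_cases hwz : (w : ℕ) + 1 = a
  · have hw : w = z := Fin.ext (by simp only [z]; omega)
    subst hw
    let p : Fin (a + b) := ⟨a - 2, by omega⟩
    have hzp : ρ.symm z < ρ.symm p := by
      by_cases hvp : v = p
      · rwa [← hvp]
      · refine hle.trans (hpos v p (by omega) (by simp only [p]; omega) (Fin.lt_def.mpr ?_))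
        have : (v : ℕ) ≠ p := fun he => hvp (Fin.ext he)
        simp only [p] at this ⊢
        omega
    refine hL (by omega) (h z) (h p) (hf hzp)
      ((hh p z).mpr (Fin.lt_def.mpr (by simp only [z, p]; omega)))
      (below _ p (by simp only [p]; omega) (by simp only [p]; omega)) (above' b _ le_rfl ?_)
    intro v hv
    exact hf (hpos p v (by simp only [p]; omega) (by omega)
      (Fin.lt_def.mpr (by simp only [p]; omega)))
  · by_cases hvz : (v : ℕ) + 1 = a
    · have hv : v = z := Fin.ext (by simp only [z]; omega)
      subst hv
      let q : Fin (a + b) := ⟨a, by omega⟩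
      have hqz : ρ.symm q < ρ.symm z := by
        by_cases hwq : w = q
        · rwa [← hwq]
        · refine (hpos q w (by simp only [q]; omega) hwz (Fin.lt_def.mpr ?_)).trans hle
          have : (w : ℕ) ≠ q := fun he => hwq (Fin.ext he)
          simp only [q] at this ⊢
          omega
      refine hR (by omega) (h z) (h q) (hf hqz)
        ((hh z q).mpr (Fin.lt_def.mpr (by simp only [z, q]; omega)))
        (above _ q (by simp only [q]; omega) le_rfl) (below' (a - 1) _ (by omega) ?_)
      intro v hv
      exact hf (hpos v q (by omega) (by simp only [q]; omega)
        (Fin.lt_def.mpr (by simp only [q]; omega)))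
    · exact absurd (hpos v w hvz hwz hvw) hle.not_gt

theorem contains_decreasing_iff {m : ℕ} :
    Contains π (decreasing m).2 ↔ ∃ S : Finset (Fin n), StrictAntiOn π S ∧ S.card = m := by
  constructor
  · rintro ⟨f, hf, hord⟩
    refine ⟨Finset.univ.map ⟨f, hf.injective⟩, ?_, by simp; rfl⟩
    rintro x hx y hy hxy
    simp only [Finset.coe_map, Function.Embedding.coeFn_mk, Finset.coe_univ, Set.image_univ,
      Set.mem_range] at hx hy
    obtain ⟨i, rfl⟩ := hx
    obtain ⟨j, rfl⟩ := hy
    rw [hord]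
    exact Fin.rev_lt_rev.mpr (hf.lt_iff_lt.mp hxy)
  · rintro ⟨S, hS, hcard⟩
    change ∃ f : Fin m → Fin n, StrictMono f ∧ ∀ i j : Fin m, π (f i) < π (f j) ↔ i.rev < j.rev
    refine ⟨S.orderEmbOfFin hcard, (S.orderEmbOfFin hcard).strictMono, fun i j => ?_⟩
    have h1 := hS.lt_iff_gt (S.orderEmbOfFin_mem hcard i) (S.orderEmbOfFin_mem hcard j)
    rw [h1, OrderEmbedding.lt_iff_lt, Fin.rev_lt_rev]

theorem noLongDecreasing_iff {m : ℕ} :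
    NoLongDecreasing m π ↔ ¬ Contains π (decreasing m).2 := by
  rw [contains_decreasing_iff]
  constructor
  · rintro h ⟨S, hS, hcard⟩
    exact (h S hS).ne hcard
  · intro h S hS
    by_contra hle
    obtain ⟨T, hT, hcard⟩ := Finset.exists_subset_card_eq (not_lt.mp hle)
    exact h ⟨T, hS.mono hT, hcard⟩

theorem mem_Av_iff {a b m : ℕ} (ha : 1 ≤ a) :
    π ∈ Av n (partialShuffle a b ∪ {decreasing m}) ↔
      NoLeftShift a b π ∧ NoRightShift a b π ∧ NoLongDecreasing m π := by
  rw [noLongDecreasing_iff]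
  constructor
  · intro h
    have h1 : ∀ ρ ∈ partialShuffle a b, ¬ Contains π ρ.2 := fun ρ hρ => h ρ (Or.inl hρ)
    exact ⟨noLeftShift_of_avoids h1, noRightShift_of_avoids ha h1, h _ (Or.inr rfl)⟩
  · rintro ⟨hL, hR, hD⟩ ρ (hρ | rfl)
    · exact avoids_of_noShift ha hL hR ρ hρ
    · exact hD

end Avoidance

/-! ### The number of breaks is bounded -/

section Breaks

variable {n : ℕ} {π : Equiv.Perm (Fin n)}

/-- There is a break of `π` after the position `e`: the entry at the next position exists, and it
is not the successor of the entry at `e`. -/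
def IsBreak (π : Equiv.Perm (Fin n)) (e : Fin n) : Prop :=
  ∃ e' : Fin n, (e' : ℕ) = e + 1 ∧ (π e' : ℕ) ≠ π e + 1

/-- If `p` and `q` form an increasing pair with a chain of length `a - 1` below `p` and a chain of
length `b` above `q`, then the entries with values between theirs are at positions between theirs. -/
theorem between_of_noShift {a b : ℕ} (ha : 1 ≤ a) (hab : 2 ≤ a + b) (hL : NoLeftShift a b π)
    (hR : NoRightShift a b π) {p q z : Fin n} (hpq : p < q) (hpz : π p < π z) (hzq : π z < π q)
    (hp : ChainBelow π (a - 1) p (π p)) (hq : ChainAbove π b q (π q)) : p < z ∧ z < q := by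
  have hpq' : (p : ℕ) < q := hpq
  have hpz' : (π p : ℕ) < π z := hpz
  have hzq' : (π z : ℕ) < π q := hzq
  constructor
  · by_contra hle
    have hne : z ≠ p := by rintro rfl; exact hpz.false
    have hzp : z < p := lt_of_le_of_ne (not_lt.mp hle) hne
    have hzp' : (z : ℕ) < p := hzp
    by_cases h2 : 2 ≤ a
    · exact hL h2 z p hzp hpz (hp.mono (by omega) le_rfl le_rfl)
        (hq.mono le_rfl (by omega) (by omega))
    · refine hR (by omega) p z hzp hpz (hq.mono (by omega) (by omega) (by omega)) ?_
      rw [show a - 1 = 0 by omega]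
      trivial
  · by_contra hle
    have hne : q ≠ z := by rintro rfl; exact hzq.false
    have hqz : q < z := lt_of_le_of_ne (not_lt.mp hle) hne
    have hqz' : (q : ℕ) < z := hqz
    by_cases h1 : 1 ≤ b
    · exact hR h1 z q hqz hzq (hq.mono (by omega) le_rfl le_rfl)
        (hp.mono le_rfl (by omega) (by omega))
    · refine hL (by omega) q z hqz hzq (hp.mono (by omega) (by omega) (by omega)) ?_
      rw [show b = 0 by omega]
      trivial

/-- A long increasing sequence of entries cannot be such that each of them is followed by a break
and the entries `y j` just after them are increasing, too: away from the ends of the sequence each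
`y j` would lie below or above the whole middle part, and either case breaks one of the rules. -/
theorem false_of_monotone_breaks {a b : ℕ} (ha : 1 ≤ a) (hab : 2 ≤ a + b)
    (hL : NoLeftShift a b π) (hR : NoRightShift a b π) (x y : ℕ → Fin n) (N : ℕ)
    (hN : 3 * (a + b) + 3 ≤ N)
    (hx : ∀ i j, i < j → j < N → x i < x j ∧ π (x i) < π (x j))
    (hy : ∀ i j, i < j → j < N → y i < y j ∧ π (y i) < π (y j))
    (hxy : ∀ j < N, (y j : ℕ) = x j + 1 ∧ (π (y j) : ℕ) ≠ π (x j) + 1) : False := by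
  have hx' : ∀ i j, i < j → j < N → (x i : ℕ) < x j ∧ (π (x i) : ℕ) < π (x j) := hx
  have below : ∀ j r, r ≤ j → j < N → ChainBelow π r (x j) (π (x j)) := fun j r hr hj =>
    chainBelow_of_strictMono hx hr hj
  have above : ∀ j r, j + r < N → ChainAbove π r (x j) (π (x j)) := fun j r hr =>
    chainAbove_of_strictMono hx hr
  have vne : ∀ u v : Fin n, (u : ℕ) ≠ v → (π u : ℕ) ≠ π v := fun u v huv h =>
    huv (congrArg Fin.val (π.injective (Fin.ext h)))
  set lo := a + b with hlo
  set hi := 2 * (a + b) + 1 with hhi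
  have side : ∀ j, lo ≤ j → j < hi →
      (π (y j) : ℕ) < π (x lo) ∨ (π (x hi) : ℕ) < π (y j) := by
    intro j hj1 hj2
    by_contra hcon
    push Not at hcon
    obtain ⟨hc1, hc2⟩ := hcon
    obtain ⟨hyx, hyv⟩ := hxy j (by omega)
    have hj := hx' j (j + 1) (by omega) (by omega)
    have hneq := vne (y j) (x j) (by omega)
    rcases lt_or_gt_of_ne hneq with hlt | hgt
    · have hlj : lo < j := by
        rcases hj1.lt_or_eq with h | h
        · exact h
        · rw [h] at hc1; omega
      have hne := vne (x lo) (y j) (by have := hx' lo j hlj (by omega); omega)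
      have := (between_of_noShift ha hab hL hR (hx lo j hlj (by omega)).1
        (show π (x lo) < π (y j) from Fin.lt_def.mpr (by omega)) hlt (below lo _ (by omega) (by omega))
        (above j b (by omega))).2
      have : (y j : ℕ) < x j := this
      omega
    · by_cases hbig : (π (x (j + 1)) : ℕ) < π (y j)
      · have hh := hx' hi (hi + 1) (by omega) (by omega)
        have := (between_of_noShift ha hab hL hR (hx (j + 1) (hi + 1) (by omega) (by omega)).1
          hbig (show π (y j) < π (x (hi + 1)) from Fin.lt_def.mpr (by omega))
          (below (j + 1) _ (by omega) (by omega)) (above (hi + 1) b (by omega))).1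
        have : (x (j + 1) : ℕ) < y j := this
        omega
      · obtain ⟨w, hw⟩ := π.surjective ⟨π (x j) + 1, by omega⟩
        have hwv : (π w : ℕ) = π (x j) + 1 := by rw [hw]
        have := between_of_noShift ha hab hL hR (p := x j) (q := y j) (z := w)
          (Fin.lt_def.mpr (by omega)) (Fin.lt_def.mpr (by omega)) (Fin.lt_def.mpr (by omega))
          (below j _ (by omega) (by omega))
          ((above (j + 1) b (by omega)).mono le_rfl (by omega) (by omega))
        have h1 : (x j : ℕ) < w := this.1
        have h2 : (w : ℕ) < y j := this.2
        omega
  set j₀ := lo + (a - 2) with hj₀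
  have hj₀x := hx' j₀ (j₀ + 1) (by omega) (by omega)
  have hj₀y := (hxy j₀ (by omega)).1
  have hj₀h := hx' (j₀ + 1) hi (by omega) (by omega)
  have hlox : (x lo : ℕ) ≤ x j₀ ∧ (π (x lo) : ℕ) ≤ π (x j₀) := by
    rcases (show lo ≤ j₀ by omega).lt_or_eq with h | h
    · have := hx' lo j₀ h (by omega); omega
    · rw [← h]; simp
  rcases side j₀ (by omega) (by omega) with hlow | hhigh
  · by_cases h2 : 2 ≤ a
    · exact hL h2 (x lo) (y j₀) (Fin.lt_def.mpr (by omega)) hlow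
        (chainBelow_of_strictMono hy (by omega) (by omega))
        ((above (j₀ + 1) b (by omega)).mono le_rfl (by omega) (by omega))
    · refine hR (by omega) (y j₀) (x lo) (Fin.lt_def.mpr (by omega)) hlow (above lo _ (by omega)) ?_
      rw [show a - 1 = 0 by omega]
      trivial
  · by_cases h1 : 1 ≤ b
    · exact hR h1 (x hi) (y j₀) (Fin.lt_def.mpr (by omega)) hhigh
        (chainAbove_of_strictMono hy (N := N) (by omega))
        ((below j₀ _ (by omega) (by omega)).mono le_rfl (by omega) (by omega))
    · refine hL (by omega) (y j₀) (x hi) (Fin.lt_def.mpr (by omega)) hhigh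
        (below hi _ (by omega) (by omega)) ?_
      rw [show b = 0 by omega]
      trivial

open Classical in
/-- The permutations in the class have boundedly many breaks. -/
theorem card_breaks_le {a b m : ℕ} (ha : 1 ≤ a) (hab : 2 ≤ a + b) (hm : 2 ≤ m)
    (hL : NoLeftShift a b π) (hR : NoRightShift a b π) (hD : NoLongDecreasing m π) :
    (Finset.univ.filter (IsBreak π)).card ≤ (3 * (a + b) + 2) * (m - 1) * (m - 1) := by
  by_contra hcon
  push Not at hcon
  let nxt : Fin n → Fin n := fun e => if h : (e : ℕ) + 1 < n then ⟨e + 1, h⟩ else e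
  have hnxt : ∀ e, IsBreak π e → (nxt e : ℕ) = e + 1 ∧ (π (nxt e) : ℕ) ≠ π e + 1 := by
    rintro e ⟨e', he', hv⟩
    have : nxt e = e' := by
      have : (e : ℕ) + 1 < n := by have := e'.2; omega
      exact Fin.ext (by simp [nxt, this, he'])
    rw [this]
    exact ⟨he', hv⟩
  rcases exists_strictMonoOn_or_strictAntiOn π _ _ _ π.injective.injOn hcon with
    ⟨S, hS, hSc, hSm⟩ | ⟨S, hS, hSc, hSm⟩
  swap
  · have := hD S hSm
    omega
  have hSB : ∀ e ∈ S, IsBreak π e := fun e he => (Finset.mem_filter.mp (hS he)).2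
  have hinj : ∀ e ∈ S, ∀ e' ∈ S, nxt e = nxt e' → e = e' := by
    intro e he e' he' h
    have h1 := (hnxt e (hSB e he)).1
    have h2 := (hnxt e' (hSB e' he')).1
    rw [h] at h1
    exact Fin.ext (by omega)
  have hSc' : (3 * (a + b) + 2) * (m - 1) < S.card := by omega
  rcases exists_strictMonoOn_or_strictAntiOn (fun e => π (nxt e)) _ _ S
    (fun e he e' he' h => hinj e he e' he' (π.injective h)) hSc' with
    ⟨T, hT, hTc, hTm⟩ | ⟨T, hT, hTc, hTm⟩
  · have hpos : 0 < 3 * (a + b) + 2 + 1 := by omega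
    let x : ℕ → Fin n := fun j => T.orderEmbOfFin hTc (Fin.ofNat _ j)
    have hxT : ∀ j, x j ∈ T := fun j => T.orderEmbOfFin_mem hTc _
    have hx : ∀ i j, i < j → j < 3 * (a + b) + 3 → x i < x j := by
      intro i j hij hj
      refine (T.orderEmbOfFin hTc).strictMono (Fin.lt_def.mpr ?_)
      simp only [Fin.val_ofNat]
      rw [Nat.mod_eq_of_lt (by omega), Nat.mod_eq_of_lt (by omega)]
      exact hij
    refine false_of_monotone_breaks ha hab hL hR x (fun j => nxt (x j)) _ le_rfl
      (fun i j hij hj => ⟨hx i j hij hj, hSm (hT (hxT i)) (hT (hxT j)) (hx i j hij hj)⟩)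
      (fun i j hij hj => ⟨?_, hTm (hxT i) (hxT j) (hx i j hij hj)⟩)
      (fun j _ => hnxt _ (hSB _ (hT (hxT j))))
    have h1 := (hnxt _ (hSB _ (hT (hxT i)))).1
    have h2 := (hnxt _ (hSB _ (hT (hxT j)))).1
    have h3 : (x i : ℕ) < x j := hx i j hij hj
    exact Fin.lt_def.mpr (by omega)
  · have : StrictAntiOn π (T.image nxt : Finset (Fin n)) := by
      intro u hu v hv huv
      obtain ⟨e, he, rfl⟩ := Finset.mem_image.mp hu
      obtain ⟨e', he', rfl⟩ := Finset.mem_image.mp hv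
      refine hTm he he' ?_
      have h1 := (hnxt _ (hSB _ (hT he))).1
      have h2 := (hnxt _ (hSB _ (hT he'))).1
      have h3 : (nxt e : ℕ) < nxt e' := huv
      exact Fin.lt_def.mpr (by omega)
    have h := hD _ this
    rw [Finset.card_image_of_injOn fun e he e' he' => hinj e (hT he) e' (hT he')] at h
    omega

end Breaks

/-! ### The number of long runs is bounded -/

section LongRuns

variable {n : ℕ} {π : Equiv.Perm (Fin n)}

/-- The position `e` is the last one of a maximal run of `π`, that is, of a maximal sequence of
adjacent positions at which the entries of `π` are consecutive integers in increasing order, and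
this run has length at least `c`. -/
def IsLongRunEnd (c : ℕ) (π : Equiv.Perm (Fin n)) (e : Fin n) : Prop :=
  (∀ r < c, ∃ p : Fin n, (p : ℕ) + r = e ∧ (π p : ℕ) + r = π e) ∧
    ∀ e' : Fin n, (e' : ℕ) = e + 1 → (π e' : ℕ) ≠ π e + 1

namespace IsLongRunEnd

variable {c : ℕ} {e e' : Fin n}

/-- An entry outside the last `c` entries of a long run is to one side of all of them, both in
position and in value. -/
theorem mem_or_outside (he : IsLongRunEnd c π e) (z : Fin n) :
    (∃ r < c, (z : ℕ) + r = e ∧ (π z : ℕ) + r = π e) ∨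
      (((z : ℕ) + c ≤ e ∨ (e : ℕ) < z) ∧ ((π z : ℕ) + c ≤ π e ∨ (π e : ℕ) < π z)) := by
  by_contra hcon
  push Not at hcon
  obtain ⟨h1, h2⟩ := hcon
  by_cases hpos : (z : ℕ) + c ≤ e ∨ (e : ℕ) < z
  · have hv := h2 hpos
    obtain ⟨p, hp, hpv⟩ := he.1 (π e - π z) (by omega)
    have : p = z := π.injective (Fin.ext (by omega))
    subst this
    exact h1 (π e - π p) (by omega) hp hpv
  · obtain ⟨p, hp, hpv⟩ := he.1 (e - z) (by omega)
    have : p = z := Fin.ext (by omega)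
    subst this
    exact h1 (e - p) (by omega) hp hpv

/-- Different long runs are separated both in position and in value. -/
theorem separated (he : IsLongRunEnd c π e) (he' : IsLongRunEnd c π e') (h : e < e') :
    (e : ℕ) + c ≤ e' ∧ ((π e : ℕ) + c ≤ π e' ∨ (π e' : ℕ) + c ≤ π e) := by
  have hlt : (e : ℕ) < e' := h
  have h1 := he.mem_or_outside e'
  rcases he'.mem_or_outside e with ⟨r, hr, hpos, hval⟩ | h2
  · obtain ⟨p, hp, hpv⟩ := he'.1 (r - 1) (by omega)
    exact absurd (by omega) (he.2 p (by omega))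
  · rcases h1 with ⟨r, hr, hpos, hval⟩ | h1 <;> omega

theorem chainBelow_of_offset (he : IsLongRunEnd c π e) {p : Fin n} {r s : ℕ} (hs : (p : ℕ) + s = e)
    (hv : (π p : ℕ) + s = π e) (hr : r + s < c) : ChainBelow π r p (π p) := by
  induction r generalizing p s with
  | zero => trivial
  | succ r ih =>
    obtain ⟨q, hq, hqv⟩ := he.1 (s + 1) (by omega)
    exact ⟨q, by omega, by omega, ih hq hqv (by omega)⟩

theorem chainAbove_of_offset (he : IsLongRunEnd c π e) {p : Fin n} {s : ℕ} (hs : (p : ℕ) + s = e)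
    (hv : (π p : ℕ) + s = π e) (hc : s < c) : ChainAbove π s p (π p) := by
  induction s generalizing p with
  | zero => trivial
  | succ s ih =>
    obtain ⟨q, hq, hqv⟩ := he.1 s (by omega)
    exact ⟨q, by omega, by omega, ih hq hqv (by omega)⟩

theorem chainBelow_self (he : IsLongRunEnd c π e) {r : ℕ} (hr : r < c) :
    ChainBelow π r e (π e) :=
  he.chainBelow_of_offset (s := 0) rfl rfl (by omega)

theorem chainBelow (he : IsLongRunEnd c π e) {r i v : ℕ} (hr : r ≤ c) (hi : (e : ℕ) < i)
    (hv : (π e : ℕ) < v) : ChainBelow π r i v := by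
  rcases r with _ | r
  · trivial
  · exact ⟨e, hi, hv, he.chainBelow_self (by omega)⟩

theorem chainAbove (he : IsLongRunEnd c π e) {r i v : ℕ} (hr : r ≤ c) (hi : i + c ≤ e)
    (hv : v + c ≤ π e) : ChainAbove π r i v := by
  rcases r with _ | r
  · trivial
  · obtain ⟨p, hp, hpv⟩ := he.1 r (by omega)
    exact ⟨p, by omega, by omega, he.chainAbove_of_offset hp hpv (by omega)⟩

end IsLongRunEnd

/-- Between two long runs, the first of which ends at `e` and the second at `e'`, there is a
*separator*: either the entry at `e` itself (if the second run is below the first), or the entry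
just after it; it lies above the second run, or else below the first while the second is above the
first. -/
theorem exists_separator {a b c : ℕ} (ha : 1 ≤ a) (hab : 2 ≤ a + b) (hc : a + b ≤ c)
    (hL : NoLeftShift a b π) (hR : NoRightShift a b π) {e e' : Fin n}
    (he : IsLongRunEnd c π e) (he' : IsLongRunEnd c π e') (hlt : e < e') :
    ∃ z : Fin n, (e : ℕ) ≤ z ∧ (z : ℕ) + c ≤ e' ∧
      ((π e' : ℕ) < π z ∨
        ((z : ℕ) = e + 1 ∧ (π z : ℕ) < π e ∧ (π e : ℕ) + c ≤ π e')) := by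
  obtain ⟨hpos, hval⟩ := he.separated he' hlt
  rcases hval with hval | hval
  swap
  · exact ⟨e, le_rfl, hpos, Or.inl (by omega)⟩
  obtain ⟨y, hy⟩ : ∃ y : Fin n, (y : ℕ) = e + 1 := ⟨⟨e + 1, by have := e'.2; omega⟩, rfl⟩
  have hne := he.2 y hy
  have hne' : (π y : ℕ) ≠ π e := fun h => by
    have := π.injective (Fin.ext h)
    rw [this] at hy
    omega
  have hy' := he'.mem_or_outside y
  rcases lt_or_gt_of_ne hne' with hlt | hgt
  · refine ⟨y, by omega, ?_, Or.inr ⟨hy, hlt, hval⟩⟩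
    rcases hy' with ⟨r, hr, h1, h2⟩ | hy' <;> omega
  by_cases hbig : (π e' : ℕ) < π y
  · refine ⟨y, by omega, ?_, Or.inl hbig⟩
    rcases hy' with ⟨r, hr, h1, h2⟩ | hy' <;> omega
  -- otherwise the successor of the value at `e` is displaced from its place just after `e`
  exfalso
  have hbound : (π e : ℕ) + 1 < n := by have := (π e').2; omega
  obtain ⟨w, hwv⟩ : ∃ w, (π w : ℕ) = π e + 1 := by
    obtain ⟨w, hw⟩ := π.surjective ⟨π e + 1, hbound⟩
    exact ⟨w, by rw [hw]⟩
  have hwe : (w : ℕ) ≠ e := fun h => by rw [Fin.ext h] at hwv; omega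
  have hwy : (w : ℕ) ≠ y := fun h => by rw [Fin.ext h] at hwv; omega
  have hew : π e < π w := Fin.lt_def.mpr (by omega)
  have hwy' : π w < π y := Fin.lt_def.mpr (by
    have : (π w : ℕ) ≠ π y := fun h => hwy (congrArg Fin.val (π.injective (Fin.ext h)))
    clear hy'
    omega)
  rcases lt_or_gt_of_ne hwe with hlt | hgt
  · have hv : (π w : ℕ) + c ≤ π e' := by
      clear hy'
      rcases he'.mem_or_outside w with ⟨r, hr, h1, h2⟩ | hw' <;> omega
    clear hy'
    by_cases h2 : 2 ≤ a
    · exact hL h2 w e hlt hew (he.chainBelow_self (by omega))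
        (he'.chainAbove (by omega) hpos hv)
    · refine hR (by omega) e w hlt hew
        (he'.chainAbove (by omega) (by omega) hv) ?_
      rw [show a - 1 = 0 by omega]
      trivial
  · by_cases h1 : 1 ≤ b
    · refine hR h1 w y (Fin.lt_def.mpr (by omega)) hwy' ?_
        (he.chainBelow (by omega) (by omega) (by omega))
      rcases hy' with ⟨r, hr, h1, h2⟩ | hy'
      · exact (he'.chainAbove_of_offset h1 h2 hr).mono (by omega) le_rfl le_rfl
      · exact he'.chainAbove (by omega) (by omega) (by omega)
    · refine hL (by omega) y w (Fin.lt_def.mpr (by omega)) hwy'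
        (he.chainBelow (by omega) (by omega) (by omega)) ?_
      rw [show b = 0 by omega]
      trivial

/-- The positions `e 0, …, e N` of the ends of long runs, in increasing order, and the position `z j`
of a separator between the runs number `j` and `j + 1` for each `j < N`. -/
structure SeparatedRuns (c : ℕ) (π : Equiv.Perm (Fin n)) (N : ℕ) (e z : ℕ → Fin n) : Prop where
  isLongRunEnd : ∀ j ≤ N, IsLongRunEnd c π (e j)
  lt : ∀ i j, i < j → j ≤ N → (e i : ℕ) < e j
  le_sep : ∀ j < N, (e j : ℕ) ≤ z j
  sep_lt : ∀ j < N, (z j : ℕ) + c ≤ e (j + 1)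
  up_or_down : ∀ j < N, (π (e (j + 1)) : ℕ) < π (z j) ∨
    ((z j : ℕ) = e j + 1 ∧ (π (z j) : ℕ) < π (e j) ∧ (π (e j) : ℕ) + c ≤ π (e (j + 1)))

namespace SeparatedRuns

variable {a b c m N : ℕ} {e z : ℕ → Fin n}

theorem le (h : SeparatedRuns c π N e z) {i j : ℕ} (hij : i ≤ j) (hj : j ≤ N) :
    (e i : ℕ) ≤ e j := by
  rcases hij.lt_or_eq with hij | rfl
  · exact (h.lt i j hij hj).le
  · exact le_rfl

theorem sep_strictMono (h : SeparatedRuns c π N e z) (hc : 1 ≤ c) {i j : ℕ} (hij : i < j)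
    (hj : j < N) : (z i : ℕ) < z j := by
  have h1 := h.sep_lt i (by omega)
  have h2 := h.le (show i + 1 ≤ j by omega) hj.le
  have h3 := h.le_sep j hj
  omega

/-- Separators form no increasing subsequence of length `a + b - 1`: its entry number `a - 1` (its
first one if `a = 1`) would break one of the rules together with one of the two adjacent runs. -/
theorem false_of_increasing (h : SeparatedRuns c π N e z) (ha : 1 ≤ a) (hab : 2 ≤ a + b)
    (hc : a + b ≤ c) (hL : NoLeftShift a b π) (hR : NoRightShift a b π) (t : ℕ → ℕ)
    (htN : ∀ j, t j < N)
    (ht : ∀ i j, i < j → j < a + b - 1 → t i < t j ∧ π (z (t i)) < π (z (t j))) : False := by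
  have hchain : ∀ i j, i < j → j < a + b - 1 →
      z (t i) < z (t j) ∧ π (z (t i)) < π (z (t j)) := fun i j hij hj =>
    ⟨h.sep_strictMono (by omega) (ht i j hij hj).1 (htN j), (ht i j hij hj).2⟩
  by_cases h2 : 2 ≤ a
  · set i := t (a - 2) with hi
    have hiN : i < N := htN _
    have hbelow : ChainBelow π (a - 2) (z i) (π (z i)) :=
      chainBelow_of_strictMono (g := fun j => z (t j)) hchain le_rfl (by omega)
    have hle := h.le_sep i hiN
    have hsl := h.sep_lt i hiN
    rcases h.up_or_down i hiN with hup | ⟨hz, hzlt, hee⟩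
    · refine hL h2 (z i) (e (i + 1)) (Fin.lt_def.mpr (by omega)) (Fin.lt_def.mpr hup)
        ((h.isLongRunEnd (i + 1) hiN).chainBelow_self (by omega)) ?_
      rcases b with _ | b
      · trivial
      · have hlt := ht (a - 2) (a - 1) (by omega) (by omega)
        have hlt2 : (π (z i) : ℕ) < π (z (t (a - 1))) := hlt.2
        have h1 := h.le (show i + 1 ≤ t (a - 1) by omega) (htN _).le
        have h3 := h.le_sep _ (htN (a - 1))
        have hne : (e (i + 1) : ℕ) ≠ z (t (a - 1)) := fun heq => by
          rw [Fin.ext heq] at hup; omega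
        exact ⟨z (t (a - 1)), by omega, hlt.2,
          chainAbove_of_strictMono (g := fun j => z (t j)) (N := a + (b + 1) - 1) hchain (by omega)⟩
    · exact hL h2 (e i) (z i) (Fin.lt_def.mpr (by omega)) (Fin.lt_def.mpr hzlt) hbelow
        ((h.isLongRunEnd (i + 1) hiN).chainAbove (by omega) hsl hee)
  · have hbelow : ∀ i v, ChainBelow π (a - 1) i v := fun i v => by
      rw [show a - 1 = 0 by omega]
      trivial
    set i := t 0 with hi
    have hiN : i < N := htN _
    have hsl := h.sep_lt i hiN
    rcases h.up_or_down i hiN with hup | ⟨hz, hzlt, hee⟩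
    · exact hR (by omega) (e (i + 1)) (z i) (Fin.lt_def.mpr (by omega)) (Fin.lt_def.mpr hup)
        (chainAbove_of_strictMono (g := fun j => z (t j)) hchain (by omega)) (hbelow _ _)
    · exact hR (by omega) (z i) (e i) (Fin.lt_def.mpr (by omega)) (Fin.lt_def.mpr hzlt)
        ((h.isLongRunEnd (i + 1) hiN).chainAbove (by omega) (by omega) hee) (hbelow _ _)

/-- Any decreasing subsequence of the separators can be extended by the end of a run, so it has
length less than `m - 1`. -/
theorem card_lt_of_decreasing (h : SeparatedRuns c π N e z) (ha : 1 ≤ a) (hab : 2 ≤ a + b)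
    (hc : a + b ≤ c) (hL : NoLeftShift a b π) (hR : NoRightShift a b π)
    (hD : NoLongDecreasing m π) (T : Finset ℕ) (hT : T.Nonempty) (hTN : ∀ j ∈ T, j < N)
    (hanti : StrictAntiOn (fun j => π (z j)) T) : T.card + 1 < m := by
  have hmono : ∀ i ∈ T, ∀ j ∈ T, i < j → z i < z j := fun i _ j hj hij =>
    h.sep_strictMono (by omega) hij (hTN j hj)
  have hle : ∀ i ∈ T, ∀ j ∈ T, i ≤ j → (z i : ℕ) ≤ z j ∧ (π (z j) : ℕ) ≤ π (z i) := by
    intro i hi j hj hij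
    rcases hij.lt_or_eq with hij | rfl
    · exact ⟨(hmono i hi j hj hij).le, (hanti hi hj hij).le⟩
    · simp
  suffices hx : ∃ x : Fin n, ∀ j ∈ T, (z j < x ∧ π x < π (z j)) ∨ (x < z j ∧ π (z j) < π x) by
    obtain ⟨x, hx⟩ := hx
    have hinj : Set.InjOn z T := by
      intro i hi j hj hij
      rcases lt_trichotomy i j with hlt | heq | hgt
      · exact absurd hij (hmono i hi j hj hlt).ne
      · exact heq
      · exact absurd hij (hmono j hj i hi hgt).ne'
    have := hD (insert x (T.image z)) ?_
    · rwa [Finset.card_insert_of_notMem, Finset.card_image_of_injOn hinj] at this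
      intro hmem
      obtain ⟨j, hj, rfl⟩ := Finset.mem_image.mp hmem
      rcases hx j hj with hx | hx <;> exact hx.1.false
    · have hcases : ∀ u ∈ insert x (T.image z), u = x ∨ ∃ j ∈ T, u = z j := by
        intro u hu
        rcases Finset.mem_insert.mp hu with rfl | hu
        · exact Or.inl rfl
        · obtain ⟨j, hj, rfl⟩ := Finset.mem_image.mp hu
          exact Or.inr ⟨j, hj, rfl⟩
      intro u hu v hv huv
      rcases hcases u hu with rfl | ⟨i, hi, rfl⟩ <;> rcases hcases v hv with rfl | ⟨j, hj, rfl⟩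
      · exact absurd huv (lt_irrefl _)
      · rcases hx j hj with hx | hx
        · exact absurd huv hx.1.not_gt
        · exact hx.2
      · rcases hx i hi with hx | hx
        · exact hx.2
        · exact absurd huv hx.1.not_gt
      · rcases lt_trichotomy i j with hlt | rfl | hgt
        · exact hanti hi hj hlt
        · exact absurd huv (lt_irrefl _)
        · exact absurd huv (hmono j hj i hi hgt).not_gt
  by_cases hmax : (π (e (T.max' hT + 1)) : ℕ) < π (z (T.max' hT))
  · refine ⟨e (T.max' hT + 1), fun j hj => Or.inl ?_⟩
    have h1 := hle j hj _ (T.max'_mem hT) (T.le_max' j hj)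
    have h2 := h.sep_lt _ (hTN _ (T.max'_mem hT))
    exact ⟨Fin.lt_def.mpr (by omega), Fin.lt_def.mpr (by omega)⟩
  -- `i₂` is the first separator in the sequence that is below the run before it
  obtain ⟨i₂, hi₂, hdown, hfirst⟩ : ∃ i ∈ T, ¬ (π (e (i + 1)) : ℕ) < π (z i) ∧
      ∀ j ∈ T, j < i → (π (e (j + 1)) : ℕ) < π (z j) := by
    have hne : (T.filter fun i => ¬ (π (e (i + 1)) : ℕ) < π (z i)).Nonempty :=
      ⟨_, Finset.mem_filter.mpr ⟨T.max'_mem hT, hmax⟩⟩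
    have hmem := Finset.mem_filter.mp (Finset.min'_mem _ hne)
    refine ⟨_, hmem.1, hmem.2, fun j hj hlt => ?_⟩
    by_contra hcon
    exact absurd (Finset.min'_le _ j (Finset.mem_filter.mpr ⟨hj, hcon⟩)) hlt.not_ge
  have hi₂N := hTN i₂ hi₂
  obtain ⟨hz₂, hlt₂, -⟩ := (h.up_or_down i₂ hi₂N).resolve_left hdown
  refine ⟨e i₂, fun j hj => ?_⟩
  rcases le_or_gt i₂ j with hij | hij
  · have h1 := hle i₂ hi₂ j hj hij
    exact Or.inr ⟨Fin.lt_def.mpr (by omega), Fin.lt_def.mpr (by omega)⟩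
  · left
    have h1 := h.sep_lt j (hTN j hj)
    have h2 := h.le (show j + 1 ≤ i₂ by omega) hi₂N.le
    refine ⟨Fin.lt_def.mpr (by omega), ?_⟩
    by_contra hcon
    have hup := hfirst j hj hij
    have hne : (π (z j) : ℕ) ≠ π (e i₂) := fun heq => by
      have := congrArg Fin.val (π.injective (Fin.ext heq))
      omega
    have hlt : (π (z j) : ℕ) < π (e i₂) := lt_of_le_of_ne (not_lt.mp hcon) hne
    have hlt' : j + 1 < i₂ := by
      rcases (show j + 1 ≤ i₂ by omega).lt_or_eq with hh | hh
      · exact hh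
      · rw [hh] at hup; omega
    have hr₂ := h.isLongRunEnd i₂ hi₂N.le
    have hr₁ := h.isLongRunEnd (j + 1) (by omega)
    have hv : (π (z j) : ℕ) + c ≤ π (e i₂) := by
      have h3 := h.lt (j + 1) i₂ hlt' hi₂N.le
      rcases hr₂.mem_or_outside (z j) with ⟨r, hr, h1', h2'⟩ | h'
      · have := (hr₁.separated hr₂ h3).1
        omega
      · omega
    have hsep := (hr₁.separated hr₂ (h.lt (j + 1) i₂ hlt' hi₂N.le)).1
    obtain ⟨q, hq, hqv⟩ := hr₂.1 b (by omega)
    have := (between_of_noShift ha hab hL hR (p := e (j + 1)) (q := q) (z := z j)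
      (Fin.lt_def.mpr (by omega)) hup (Fin.lt_def.mpr (by omega)) (hr₁.chainBelow_self (by omega))
      (hr₂.chainAbove_of_offset hq hqv (by omega))).1
    have : (e (j + 1) : ℕ) < z j := this
    omega

end SeparatedRuns

/-- The permutations in the class have at most `(a + b - 2) * (m - 2) + 1` long runs. -/
theorem card_longRunEnds_le {a b c m : ℕ} (ha : 1 ≤ a) (hab : 2 ≤ a + b) (hm : 2 ≤ m)
    (hc : a + b ≤ c) (hL : NoLeftShift a b π) (hR : NoRightShift a b π)
    (hD : NoLongDecreasing m π) (E : Finset (Fin n)) (hE : ∀ e ∈ E, IsLongRunEnd c π e) :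
    E.card ≤ (a + b - 2) * (m - 2) + 1 := by
  by_contra hcon
  push Not at hcon
  obtain ⟨N, hN⟩ : ∃ N, E.card = N + 1 := ⟨E.card - 1, by omega⟩
  let e : ℕ → Fin n := fun j => E.orderEmbOfFin hN (Fin.ofNat _ j)
  have heE : ∀ j, e j ∈ E := fun j => E.orderEmbOfFin_mem hN _
  have helt : ∀ i j, i < j → j ≤ N → e i < e j := by
    intro i j hij hj
    refine (E.orderEmbOfFin hN).strictMono (Fin.lt_def.mpr ?_)
    simp only [Fin.val_ofNat]
    rw [Nat.mod_eq_of_lt (by omega), Nat.mod_eq_of_lt (by omega)]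
    exact hij
  have hz : ∀ j, ∃ z : Fin n, j < N → ((e j : ℕ) ≤ z ∧ (z : ℕ) + c ≤ e (j + 1) ∧
      ((π (e (j + 1)) : ℕ) < π z ∨
        ((z : ℕ) = e j + 1 ∧ (π z : ℕ) < π (e j) ∧ (π (e j) : ℕ) + c ≤ π (e (j + 1))))) := by
    intro j
    by_cases hj : j < N
    · obtain ⟨z, hz⟩ := exists_separator ha hab hc hL hR (hE _ (heE j)) (hE _ (heE (j + 1)))
        (helt j (j + 1) (by omega) hj)
      exact ⟨z, fun _ => hz⟩
    · exact ⟨e j, fun h => absurd h hj⟩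
  choose z hz using hz
  have hsep : SeparatedRuns c π N e z :=
    ⟨fun j _ => hE _ (heE j), helt, fun j hj => (hz j hj).1, fun j hj => (hz j hj).2.1,
      fun j hj => (hz j hj).2.2⟩
  have hinj : Set.InjOn (fun j => π (z j)) (Finset.range N) := by
    intro i hi j hj hij
    have hij' := congrArg Fin.val (π.injective hij)
    simp only [Finset.coe_range, Set.mem_Iio] at hi hj
    rcases lt_trichotomy i j with hlt | heq | hgt
    · exact absurd hij' (hsep.sep_strictMono (by omega) hlt hj).ne
    · exact heq
    · exact absurd hij' (hsep.sep_strictMono (by omega) hgt hi).ne'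
  rcases exists_strictMonoOn_or_strictAntiOn (fun j => π (z j)) (a + b - 2) (m - 2)
    (Finset.range N) hinj (by rw [Finset.card_range]; omega) with
    ⟨T, hT, hTc, hTm⟩ | ⟨T, hT, hTc, hTm⟩
  · let t : ℕ → ℕ := fun j => T.orderEmbOfFin hTc (Fin.ofNat _ j)
    have htT : ∀ j, t j ∈ T := fun j => T.orderEmbOfFin_mem hTc _
    refine hsep.false_of_increasing ha hab hc hL hR t (fun j => Finset.mem_range.mp (hT (htT j))) ?_
    intro i j hij hj
    have hlt : t i < t j := by
      refine (T.orderEmbOfFin hTc).strictMono (Fin.lt_def.mpr ?_)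
      simp only [Fin.val_ofNat]
      rw [Nat.mod_eq_of_lt (by omega), Nat.mod_eq_of_lt (by omega)]
      exact hij
    exact ⟨hlt, hTm (htT i) (htT j) hlt⟩
  · have := hsep.card_lt_of_decreasing ha hab hc hL hR hD T (Finset.card_pos.mp (by omega))
      (fun j hj => Finset.mem_range.mp (hT hj)) hTm
    omega

end LongRuns

/-! ### A permutation with many long runs -/

section Construction

/-- The sequence `0, 1, 2, …` with each of its segments of length `M` starting at a multiple of `M`
reversed: an arrangement in rows, which increase, of decreasing sequences of length `M`. -/
def revBlocks (M i : ℕ) : ℕ := i / M * M + (M - 1 - i % M)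

theorem revBlocks_lt {M A i : ℕ} (h : i < A * M) : revBlocks M i < A * M := by
  have hM : 0 < M := Nat.pos_of_ne_zero fun h0 => by simp [h0] at h
  have h1 : i / M + 1 ≤ A := Nat.succ_le_of_lt ((Nat.div_lt_iff_lt_mul hM).mpr h)
  have h2 := Nat.mul_le_mul_right M h1
  have h3 := Nat.add_one_mul (i / M) M
  unfold revBlocks
  omega

theorem revBlocks_lt_of_div_lt {M i j : ℕ} (hM : 0 < M) (h : i / M < j / M) :
    revBlocks M i < revBlocks M j := by
  have h2 := Nat.mul_le_mul_right M (show i / M + 1 ≤ j / M from h)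
  have h3 := Nat.add_one_mul (i / M) M
  unfold revBlocks
  omega

theorem revBlocks_lt_of_div_eq {M i j : ℕ} (hM : 0 < M) (hij : i < j) (h : i / M = j / M) :
    revBlocks M j < revBlocks M i := by
  have h1 := Nat.div_add_mod i M
  have h2 := Nat.div_add_mod j M
  have h3 := Nat.mod_lt j hM
  unfold revBlocks
  rw [h] at h1 ⊢
  omega

/-- The number of gaps between consecutive runs of the permutation to be constructed: `A * M` with a low
separator, then `t` where the next run is below the last one, then `B * M` with a high separator. -/
def numGaps (A B M t : ℕ) : ℕ := A * M + t + B * M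

/-- The number of gaps without a separator before the run number `q`. -/
def blockIndex (A M t q : ℕ) : ℕ := min (q - A * M) t

/-- The cells of the permutation to be constructed, numbered from left to right: the cell `2 * q` stands
for the run number `q`, and the cell `2 * i + 1` for the separator in the gap after the run number
`i`. -/
def IsCell (A B M t x : ℕ) : Prop :=
  x ≤ 2 * numGaps A B M t ∧ (x % 2 = 1 → x / 2 < A * M ∨ A * M + t ≤ x / 2)

/-- The height of a cell. The low separators are below all runs, the high ones above, both arranged
as in `revBlocks`; runs are increasing within a block, and later blocks are below earlier ones. -/
def cellHeight (A B M t x : ℕ) : ℕ :=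
  if x % 2 = 0 then
    A * M + (t - blockIndex A M t (x / 2)) * (numGaps A B M t + 1) + x / 2
  else if x / 2 < A * M then revBlocks M (x / 2)
  else A * M + (t + 1) * (numGaps A B M t + 1) + revBlocks M (x / 2 - (A * M + t))

variable {A B M t : ℕ}

theorem IsCell.cases {x : ℕ} (h : IsCell A B M t x) :
    (∃ q ≤ numGaps A B M t, x = 2 * q) ∨ (∃ i < A * M, x = 2 * i + 1) ∨
      ∃ i < B * M, x = 2 * (A * M + t + i) + 1 := by
  obtain ⟨h1, h2⟩ := h
  have hD : numGaps A B M t = A * M + t + B * M := rfl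
  by_cases hx : x % 2 = 0
  · exact Or.inl ⟨x / 2, by omega, by omega⟩
  · rcases h2 (by omega) with h | h
    · exact Or.inr (Or.inl ⟨x / 2, h, by omega⟩)
    · exact Or.inr (Or.inr ⟨x / 2 - (A * M + t), by omega, by omega⟩)

theorem isCell_run {q : ℕ} (hq : q ≤ numGaps A B M t) : IsCell A B M t (2 * q) :=
  ⟨by omega, by omega⟩

theorem isCell_low {i : ℕ} (hi : i < A * M) : IsCell A B M t (2 * i + 1) := by
  have hD : numGaps A B M t = A * M + t + B * M := rfl
  exact ⟨by omega, fun _ => Or.inl (by omega)⟩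

theorem isCell_high {i : ℕ} (hi : i < B * M) : IsCell A B M t (2 * (A * M + t + i) + 1) := by
  have hD : numGaps A B M t = A * M + t + B * M := rfl
  exact ⟨by omega, fun _ => Or.inr (by omega)⟩

theorem cellHeight_run (q : ℕ) : cellHeight A B M t (2 * q) =
    A * M + (t - blockIndex A M t q) * (numGaps A B M t + 1) + q := by
  have h1 : 2 * q % 2 = 0 := by omega
  have h2 : 2 * q / 2 = q := by omega
  rw [cellHeight, if_pos h1, h2]

theorem cellHeight_low {i : ℕ} (hi : i < A * M) :
    cellHeight A B M t (2 * i + 1) = revBlocks M i := by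
  have h1 : ¬ (2 * i + 1) % 2 = 0 := by omega
  have h2 : (2 * i + 1) / 2 = i := by omega
  rw [cellHeight, if_neg h1, h2, if_pos hi]

theorem cellHeight_high (i : ℕ) : cellHeight A B M t (2 * (A * M + t + i) + 1) =
    A * M + (t + 1) * (numGaps A B M t + 1) + revBlocks M i := by
  have h1 : ¬ (2 * (A * M + t + i) + 1) % 2 = 0 := by omega
  have h2 : (2 * (A * M + t + i) + 1) / 2 = A * M + t + i := by omega
  have h3 : ¬ A * M + t + i < A * M := by omega
  have h4 : A * M + t + i - (A * M + t) = i := by omega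
  rw [cellHeight, if_neg h1, h2, if_neg h3, h4]

theorem low_lt_run {i : ℕ} (hi : i < A * M) (q : ℕ) :
    cellHeight A B M t (2 * i + 1) < cellHeight A B M t (2 * q) := by
  rw [cellHeight_low hi, cellHeight_run]
  have := revBlocks_lt hi
  omega

theorem run_lt_high {q : ℕ} (hq : q ≤ numGaps A B M t) (i : ℕ) :
    cellHeight A B M t (2 * q) < cellHeight A B M t (2 * (A * M + t + i) + 1) := by
  rw [cellHeight_high, cellHeight_run]
  have h1 := Nat.mul_le_mul_right (numGaps A B M t + 1) (Nat.sub_le t (blockIndex A M t q))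
  have h2 := Nat.add_one_mul t (numGaps A B M t + 1)
  omega

theorem low_lt_high {i j : ℕ} (hi : i < A * M) :
    cellHeight A B M t (2 * i + 1) < cellHeight A B M t (2 * (A * M + t + j) + 1) :=
  (low_lt_run hi 0).trans (run_lt_high (Nat.zero_le _) j)

theorem blockIndex_mono {q q' : ℕ} (h : q ≤ q') : blockIndex A M t q ≤ blockIndex A M t q' := by
  unfold blockIndex
  omega

theorem run_lt_run_of_eq {q q' : ℕ} (h : q < q') (hb : blockIndex A M t q = blockIndex A M t q') :
    cellHeight A B M t (2 * q) < cellHeight A B M t (2 * q') := by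
  rw [cellHeight_run, cellHeight_run, hb]
  omega

theorem run_lt_run_of_lt {q q' : ℕ} (hq : q' ≤ numGaps A B M t)
    (hb : blockIndex A M t q < blockIndex A M t q') :
    cellHeight A B M t (2 * q') < cellHeight A B M t (2 * q) := by
  rw [cellHeight_run, cellHeight_run]
  have hle : blockIndex A M t q' ≤ t := min_le_right _ _
  have h1 := Nat.mul_le_mul_right (numGaps A B M t + 1)
    (show t - blockIndex A M t q' + 1 ≤ t - blockIndex A M t q by omega)
  have h2 := Nat.add_one_mul (t - blockIndex A M t q') (numGaps A B M t + 1)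
  omega

theorem low_lt_low_iff {i j : ℕ} (hij : i < j) (hj : j < A * M) :
    cellHeight A B M t (2 * i + 1) < cellHeight A B M t (2 * j + 1) ↔ i / M < j / M := by
  have hM : 0 < M := Nat.pos_of_ne_zero fun h0 => by simp [h0] at hj
  rw [cellHeight_low (hij.trans hj), cellHeight_low hj]
  refine ⟨fun h => (Nat.div_le_div_right hij.le).lt_of_ne fun he => ?_,
    revBlocks_lt_of_div_lt hM⟩
  exact absurd h (revBlocks_lt_of_div_eq hM hij he).not_gt

theorem high_lt_high_iff {i j : ℕ} (hij : i < j) (hj : j < B * M) :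
    cellHeight A B M t (2 * (A * M + t + i) + 1) < cellHeight A B M t (2 * (A * M + t + j) + 1) ↔
      i / M < j / M := by
  have hM : 0 < M := Nat.pos_of_ne_zero fun h0 => by simp [h0] at hj
  rw [cellHeight_high, cellHeight_high, Nat.add_lt_add_iff_left]
  refine ⟨fun h => (Nat.div_le_div_right hij.le).lt_of_ne fun he => ?_,
    revBlocks_lt_of_div_lt hM⟩
  exact absurd h (revBlocks_lt_of_div_eq hM hij he).not_gt

theorem cellHeight_ne_of_lt {x y : ℕ} (hx : IsCell A B M t x) (hy : IsCell A B M t y)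
    (hxy : x < y) : cellHeight A B M t x ≠ cellHeight A B M t y := by
  rcases hx.cases with ⟨q, hq, rfl⟩ | ⟨i, hi, rfl⟩ | ⟨i, hi, rfl⟩ <;>
    rcases hy.cases with ⟨q', hq', rfl⟩ | ⟨j, hj, rfl⟩ | ⟨j, hj, rfl⟩
  · rcases (blockIndex_mono (A := A) (M := M) (t := t) (show q ≤ q' by omega)).lt_or_eq with h | h
    · exact (run_lt_run_of_lt hq' h).ne'
    · exact (run_lt_run_of_eq (by omega) h).ne
  · exact (low_lt_run hj q).ne'
  · exact (run_lt_high hq j).ne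
  · exact (low_lt_run hi q').ne
  · have hM : 0 < M := Nat.pos_of_ne_zero fun h0 => by simp [h0] at hj
    rw [cellHeight_low hi, cellHeight_low hj]
    rcases (Nat.div_le_div_right (c := M) (show i ≤ j by omega)).lt_or_eq with h | h
    · exact (revBlocks_lt_of_div_lt hM h).ne
    · exact (revBlocks_lt_of_div_eq hM (by omega) h).ne'
  · exact (low_lt_high hi).ne
  · exact (run_lt_high hq' i).ne'
  · exact (low_lt_high hj).ne'
  · have hM : 0 < M := Nat.pos_of_ne_zero fun h0 => by simp [h0] at hj
    rw [cellHeight_high, cellHeight_high]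
    rcases (Nat.div_le_div_right (c := M) (show i ≤ j by omega)).lt_or_eq with h | h
    · have := revBlocks_lt_of_div_lt hM h
      omega
    · have := revBlocks_lt_of_div_eq hM (show i < j by omega) h
      omega

theorem cellHeight_injOn {x y : ℕ} (hx : IsCell A B M t x) (hy : IsCell A B M t y)
    (h : cellHeight A B M t x = cellHeight A B M t y) : x = y := by
  rcases lt_trichotomy x y with hlt | heq | hgt
  · exact absurd h (cellHeight_ne_of_lt hx hy hlt)
  · exact heq
  · exact absurd h.symm (cellHeight_ne_of_lt hy hx hgt)

/-- A colouring of the cells with `M + 1` colours in which the two entries of an inversion never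
have the same colour. -/
def cellColor (A M t x : ℕ) : ℕ :=
  if x % 2 = 0 then blockIndex A M t (x / 2)
  else if x / 2 < A * M then x / 2 % M + 1
  else if (x / 2 - (A * M + t)) % M < t then (x / 2 - (A * M + t)) % M
  else (x / 2 - (A * M + t)) % M + 1

theorem cellColor_run (q : ℕ) :
    cellColor A M t (2 * q) = blockIndex A M t q := by
  have h1 : 2 * q % 2 = 0 := by omega
  have h2 : 2 * q / 2 = q := by omega
  rw [cellColor, if_pos h1, h2]

theorem cellColor_low {i : ℕ} (hi : i < A * M) :
    cellColor A M t (2 * i + 1) = i % M + 1 := by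
  have h1 : ¬ (2 * i + 1) % 2 = 0 := by omega
  have h2 : (2 * i + 1) / 2 = i := by omega
  rw [cellColor, if_neg h1, h2, if_pos hi]

theorem cellColor_high (i : ℕ) :
    cellColor A M t (2 * (A * M + t + i) + 1) = if i % M < t then i % M else i % M + 1 := by
  have h1 : ¬ (2 * (A * M + t + i) + 1) % 2 = 0 := by omega
  have h2 : (2 * (A * M + t + i) + 1) / 2 = A * M + t + i := by omega
  have h3 : ¬ A * M + t + i < A * M := by omega
  have h4 : A * M + t + i - (A * M + t) = i := by omega
  rw [cellColor, if_neg h1, h2, if_neg h3, h4]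

/-- `π` consists of the cells described by `IsCell` and `cellHeight`, where runs have length `c` and
separators are single entries; the entry at position `i` is the one number `off i` of the cell
`cell i`. -/
structure IsCellPerm (A B M t c : ℕ) {n : ℕ} (π : Equiv.Perm (Fin n)) (cell off : Fin n → ℕ) :
    Prop where
  isCell : ∀ i, IsCell A B M t (cell i)
  off_lt : ∀ i, off i < c
  off_eq_zero : ∀ i, cell i % 2 = 1 → off i = 0
  exists_eq : ∀ x y, IsCell A B M t x → y < c → (x % 2 = 1 → y = 0) → ∃ i, cell i = x ∧ off i = y
  lt_iff : ∀ i j, i < j ↔ cell i < cell j ∨ cell i = cell j ∧ off i < off j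
  apply_lt_iff : ∀ i j, π i < π j ↔ cellHeight A B M t (cell i) < cellHeight A B M t (cell j) ∨
    cellHeight A B M t (cell i) = cellHeight A B M t (cell j) ∧ off i < off j

theorem exists_isCellPerm (A B M t c : ℕ) :
    ∃ (n : ℕ) (π : Equiv.Perm (Fin n)) (cell off : Fin n → ℕ), IsCellPerm A B M t c π cell off := by
  classical
  let S : Finset (ℕ × ℕ) := (Finset.range (2 * numGaps A B M t + 1) ×ˢ Finset.range c).filter
    fun p => IsCell A B M t p.1 ∧ (p.1 % 2 = 1 → p.2 = 0)
  have hS : ∀ p, p ∈ S ↔ IsCell A B M t p.1 ∧ p.2 < c ∧ (p.1 % 2 = 1 → p.2 = 0) := by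
    intro p
    simp only [S, Finset.mem_filter, Finset.mem_product, Finset.mem_range]
    refine ⟨fun h => ⟨h.2.1, h.1.2, h.2.2⟩, fun h => ⟨⟨?_, h.2.1⟩, h.1, h.2.2⟩⟩
    have := h.1.1
    omega
  let S' : Finset (ℕ ×ₗ ℕ) := S.map toLex.toEmbedding
  let f : Fin S'.card ↪o ℕ ×ₗ ℕ := S'.orderEmbOfFin rfl
  have hfS : ∀ i, ofLex (f i) ∈ S := fun i => by
    have : f i ∈ S' := S'.orderEmbOfFin_mem rfl i
    obtain ⟨p, hp, hpf⟩ := Finset.mem_map.mp this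
    rw [← hpf]
    exact hp
  let key : Fin S'.card → ℕ ×ₗ ℕ := fun i =>
    toLex (cellHeight A B M t (ofLex (f i)).1, (ofLex (f i)).2)
  have hkey : Function.Injective key := by
    intro i j hij
    have h := Prod.ext_iff.mp (toLex.injective hij)
    have h1 := cellHeight_injOn ((hS _).mp (hfS i)).1 ((hS _).mp (hfS j)).1 h.1
    exact f.injective (ofLex.injective (Prod.ext h1 h.2))
  obtain ⟨π, hπ⟩ := exists_perm_of_key key hkey
  refine ⟨_, π, fun i => (ofLex (f i)).1, fun i => (ofLex (f i)).2, ?_⟩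
  refine ⟨fun i => ((hS _).mp (hfS i)).1, fun i => ((hS _).mp (hfS i)).2.1,
    fun i => ((hS _).mp (hfS i)).2.2, ?_, fun i j => ?_, fun i j => ?_⟩
  · intro x y hx hy hxy
    have hmem : toLex (x, y) ∈ S' := Finset.mem_map_of_mem toLex.toEmbedding
      ((hS (x, y)).mpr ⟨hx, hy, hxy⟩)
    have : toLex (x, y) ∈ Set.range f := by
      rw [Finset.range_orderEmbOfFin]
      exact hmem
    obtain ⟨i, hi⟩ := this
    exact ⟨i, by rw [hi]; rfl, by rw [hi]; rfl⟩
  · rw [← f.lt_iff_lt, Prod.Lex.lt_iff]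
  · rw [hπ, Prod.Lex.lt_iff]
    rfl

namespace IsCellPerm

variable {c n : ℕ} {π : Equiv.Perm (Fin n)} {cell off : Fin n → ℕ}

theorem cell_lt_of_inversion (h : IsCellPerm A B M t c π cell off) {i j : Fin n} (hij : i < j)
    (hπ : π j < π i) :
    cell i < cell j ∧ cellHeight A B M t (cell j) < cellHeight A B M t (cell i) := by
  rcases (h.lt_iff i j).mp hij with h1 | h1 <;> rcases (h.apply_lt_iff j i).mp hπ with h2 | h2
  · exact ⟨h1, h2⟩
  · have := cellHeight_injOn (h.isCell j) (h.isCell i) h2.1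
    omega
  · rw [h1.1] at h2
    omega
  · omega

theorem height_le (h : IsCellPerm A B M t c π cell off) {i j : Fin n} (hπ : π i < π j) :
    cellHeight A B M t (cell i) ≤ cellHeight A B M t (cell j) := by
  rcases (h.apply_lt_iff i j).mp hπ with h1 | h1
  · exact h1.le
  · exact h1.1.le

theorem cell_le (h : IsCellPerm A B M t c π cell off) {i j : Fin n} (hij : i < j) :
    cell i ≤ cell j := by
  rcases (h.lt_iff i j).mp hij with h1 | h1
  · exact h1.le
  · exact h1.1.le

theorem cell_ne_of_lt (h : IsCellPerm A B M t c π cell off) {i j : Fin n} (hij : i < j)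
    (hodd : cell i % 2 = 1) : cell i ≠ cell j := by
  intro he
  have h1 := h.off_eq_zero i hodd
  have h2 := h.off_eq_zero j (he ▸ hodd)
  rcases (h.lt_iff i j).mp hij with h3 | h3 <;> omega

/-- An entry above a high separator is a high separator. -/
theorem high_of_lt (h : IsCellPerm A B M t c π cell off) {p p' : Fin n} {i : ℕ}
    (hp : cell p = 2 * (A * M + t + i) + 1) (hpp' : π p < π p') :
    ∃ j < B * M, cell p' = 2 * (A * M + t + j) + 1 := by
  have hle := h.height_le hpp'
  rw [hp] at hle
  rcases (h.isCell p').cases with ⟨q, hq, he⟩ | ⟨j, hj, he⟩ | hh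
  · rw [he] at hle
    exact absurd (run_lt_high hq i) hle.not_gt
  · rw [he] at hle
    exact absurd (low_lt_high hj) hle.not_gt
  · exact hh

/-- An entry below a low separator is a low separator. -/
theorem low_of_lt (h : IsCellPerm A B M t c π cell off) {p p' : Fin n} {i : ℕ} (hi : i < A * M)
    (hp : cell p = 2 * i + 1) (hpp' : π p' < π p) : ∃ j < A * M, cell p' = 2 * j + 1 := by
  have hle := h.height_le hpp'
  rw [hp] at hle
  rcases (h.isCell p').cases with ⟨q, hq, he⟩ | hh | ⟨j, hj, he⟩
  · rw [he] at hle
    exact absurd (low_lt_run hi q) hle.not_gt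
  · exact hh
  · rw [he] at hle
    exact absurd (low_lt_high hi) hle.not_gt

theorem row_add_lt_of_chainAbove (h : IsCellPerm A B M t c π cell off) {r : ℕ} {p : Fin n} {i : ℕ}
    (hi : i < B * M) (hp : cell p = 2 * (A * M + t + i) + 1) (hc : ChainAbove π r p (π p)) :
    i / M + r < B := by
  have hM : 0 < M := Nat.pos_of_ne_zero fun h0 => by simp [h0] at hi
  induction r generalizing p i with
  | zero => exact (Nat.div_lt_iff_lt_mul hM).mpr hi
  | succ r ih =>
    obtain ⟨p', h1, h2, hr⟩ := hc
    obtain ⟨j, hj, hp'⟩ := h.high_of_lt hp h2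
    have hle := h.cell_le h1
    have hne := h.cell_ne_of_lt h1 (by omega)
    have hv := h.height_le h2
    rw [hp, hp'] at hv
    have hne' := cellHeight_ne_of_lt (isCell_high (A := A) (t := t) hi) (isCell_high hj) (by omega)
    have := (high_lt_high_iff (t := t) (show i < j by omega) hj).mp (hv.lt_of_ne hne')
    have := ih hj hp' hr
    omega

theorem le_row_of_chainBelow (h : IsCellPerm A B M t c π cell off) {r : ℕ} {p : Fin n} {i : ℕ}
    (hi : i < A * M) (hp : cell p = 2 * i + 1) (hc : ChainBelow π r p (π p)) : r ≤ i / M := by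
  induction r generalizing p i with
  | zero => exact Nat.zero_le _
  | succ r ih =>
    obtain ⟨p', h1, h2, hr⟩ := hc
    obtain ⟨j, hj, hp'⟩ := h.low_of_lt hi hp h2
    have hle := h.cell_le h1
    have hne := h.cell_ne_of_lt h1 (by omega)
    have hv := h.height_le h2
    rw [hp, hp'] at hv
    have hne' := cellHeight_ne_of_lt (isCell_low (B := B) (t := t) hj) (isCell_low hi) (by omega)
    have := (low_lt_low_iff (t := t) (show j < i by omega) hi).mp (hv.lt_of_ne hne')
    have := ih hj hp' hr
    omega

theorem blockIndex_lt_of_inversion (h : IsCellPerm A B M t c π cell off) {i j : Fin n} {q q' : ℕ}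
    (hij : i < j) (hπ : π j < π i) (hi : cell i = 2 * q) (hj : cell j = 2 * q') :
    blockIndex A M t q < blockIndex A M t q' := by
  obtain ⟨h1, h2⟩ := h.cell_lt_of_inversion hij hπ
  rw [hi, hj] at h1 h2
  refine (blockIndex_mono (by omega)).lt_of_ne fun he => ?_
  exact absurd h2 (run_lt_run_of_eq (by omega) he).not_gt

theorem noLeftShift {a b : ℕ} (h : IsCellPerm A B M t c π cell off) (hA : A ≤ a - 2)
    (hB : B ≤ b - 1) (hb : b = 0 → t = 0) : NoLeftShift a b π := by
  intro ha z p hzp hpz hbelow habove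
  obtain ⟨hcell, hheight⟩ := h.cell_lt_of_inversion hzp hpz
  have hlow : ¬ ∃ i < A * M, cell p = 2 * i + 1 := by
    rintro ⟨i, hi, hp⟩
    have hM : 0 < M := Nat.pos_of_ne_zero fun h0 => by simp [h0] at hi
    have h1 := h.le_row_of_chainBelow hi hp hbelow
    have h2 := (Nat.div_lt_iff_lt_mul hM).mpr hi
    omega
  -- only high separators are above `z` and to the right of `p`
  have hhigh : ∀ p', p < p' → π z < π p' → ∃ j < B * M, cell p' = 2 * (A * M + t + j) + 1 := by
    intro p' hpp' hzp'
    rcases (h.isCell z).cases with ⟨q, hq, hz⟩ | ⟨i, hi, hz⟩ | ⟨i, hi, hz⟩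
    · rcases (h.isCell p).cases with ⟨q', hq', hp⟩ | hh | ⟨i, hi, hp⟩
      · have hb1 := h.blockIndex_lt_of_inversion hzp hpz hz hp
        have hle := h.cell_le hpp'
        have hv := h.height_le hzp'
        rcases (h.isCell p').cases with ⟨q₂, hq₂, hp'⟩ | ⟨j, hj, hp'⟩ | hh
        · have hb2 := blockIndex_mono (A := A) (M := M) (t := t) (show q' ≤ q₂ by omega)
          rw [hz, hp'] at hv
          exact absurd (run_lt_run_of_lt hq₂ (hb1.trans_le hb2)) hv.not_gt
        · rw [hz, hp'] at hv
          exact absurd (low_lt_run hj q) hv.not_gt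
        · exact hh
      · exact absurd hh hlow
      · rw [hz, hp] at hheight
        exact absurd (run_lt_high hq i) hheight.not_gt
    · exact absurd (h.low_of_lt hi hz hpz) hlow
    · exact h.high_of_lt hz hzp'
  rcases b with _ | b
  · have hB0 : B = 0 := by omega
    subst hB0
    have ht : t = 0 := hb rfl
    subst ht
    rcases (h.isCell p).cases with ⟨q', hq', hp⟩ | hh | ⟨i, hi, hp⟩
    · rcases (h.isCell z).cases with ⟨q, hq, hz⟩ | ⟨i, hi, hz⟩ | ⟨i, hi, hz⟩
      · have hb1 := h.blockIndex_lt_of_inversion hzp hpz hz hp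
        simp [blockIndex] at hb1
      · exact hlow (h.low_of_lt hi hz hpz)
      · simp at hi
    · exact hlow hh
    · simp at hi
  · obtain ⟨p', hpp', hzp', hr⟩ := habove
    obtain ⟨j, hj, hp'⟩ := hhigh p' hpp' hzp'
    have := (Nat.le_add_left _ _).trans_lt (h.row_add_lt_of_chainAbove hj hp' hr)
    omega

theorem noRightShift {a b : ℕ} (h : IsCellPerm A B M t c π cell off) (hA : A ≤ a - 2)
    (hB : B ≤ b - 1) (ha : a ≤ 1 → t = 0) : NoRightShift a b π := by
  intro hb z q hqz hzq habove hbelow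
  obtain ⟨hcell, hheight⟩ := h.cell_lt_of_inversion hqz hzq
  have hhigh : ¬ ∃ i < B * M, cell q = 2 * (A * M + t + i) + 1 := by
    rintro ⟨i, hi, hq⟩
    have := (Nat.le_add_left _ _).trans_lt (h.row_add_lt_of_chainAbove hi hq habove)
    omega
  -- only low separators are below `z` and to the left of `q`
  have hlow : ∀ p', p' < q → π p' < π z → ∃ j < A * M, cell p' = 2 * j + 1 := by
    intro p' hp'q hp'z
    rcases (h.isCell z).cases with ⟨k, hk, hz⟩ | ⟨i, hi, hz⟩ | ⟨i, hi, hz⟩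
    · rcases (h.isCell q).cases with ⟨k', hk', hq⟩ | ⟨i, hi, hq⟩ | hh
      · have hb1 := h.blockIndex_lt_of_inversion hqz hzq hq hz
        have hle := h.cell_le hp'q
        have hv := h.height_le hp'z
        rcases (h.isCell p').cases with ⟨k₂, hk₂, hp'⟩ | hh | ⟨j, hj, hp'⟩
        · have hb2 := blockIndex_mono (A := A) (M := M) (t := t) (show k₂ ≤ k' by omega)
          rw [hz, hp'] at hv
          exact absurd (run_lt_run_of_lt hk (hb2.trans_lt hb1)) hv.not_gt
        · exact hh
        · rw [hz, hp'] at hv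
          exact absurd (run_lt_high hk j) hv.not_gt
      · rw [hz, hq] at hheight
        exact absurd (low_lt_run hi k) hheight.not_gt
      · exact absurd hh hhigh
    · exact h.low_of_lt hi hz hp'z
    · exact absurd (h.high_of_lt hz hzq) hhigh
  by_cases ha2 : 2 ≤ a
  · rw [show a - 1 = a - 2 + 1 by omega] at hbelow
    obtain ⟨p', hp'q, hp'z, hr⟩ := hbelow
    obtain ⟨j, hj, hp'⟩ := hlow p' hp'q hp'z
    have hM : 0 < M := Nat.pos_of_ne_zero fun h0 => by simp [h0] at hj
    have h1 := h.le_row_of_chainBelow hj hp' hr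
    have h2 := (Nat.div_lt_iff_lt_mul hM).mpr hj
    omega
  · have hA0 : A = 0 := by omega
    subst hA0
    have ht : t = 0 := ha (by omega)
    subst ht
    rcases (h.isCell q).cases with ⟨k', hk', hq⟩ | ⟨i, hi, hq⟩ | hh
    · rcases (h.isCell z).cases with ⟨k, hk, hz⟩ | ⟨i, hi, hz⟩ | ⟨i, hi, hz⟩
      · have hb1 := h.blockIndex_lt_of_inversion hqz hzq hq hz
        simp [blockIndex] at hb1
      · simp at hi
      · exact hhigh (h.high_of_lt hz hzq)
    · simp at hi
    · exact hhigh hh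

theorem cellColor_lt (h : IsCellPerm A B M t c π cell off) (ht : t ≤ M) (i : Fin n) :
    cellColor A M t (cell i) < M + 1 := by
  rcases (h.isCell i).cases with ⟨q, hq, he⟩ | ⟨k, hk, he⟩ | ⟨k, hk, he⟩
  · rw [he, cellColor_run]
    have : blockIndex A M t q ≤ t := min_le_right _ _
    omega
  · have hM : 0 < M := Nat.pos_of_ne_zero fun h0 => by simp [h0] at hk
    have := Nat.mod_lt k hM
    rw [he, cellColor_low hk]
    omega
  · have hM : 0 < M := Nat.pos_of_ne_zero fun h0 => by simp [h0] at hk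
    have := Nat.mod_lt k hM
    rw [he, cellColor_high]
    split_ifs <;> omega

theorem cellColor_ne_of_inversion (h : IsCellPerm A B M t c π cell off)
    {i j : Fin n} (hij : i < j) (hπ : π j < π i) :
    cellColor A M t (cell i) ≠ cellColor A M t (cell j) := by
  obtain ⟨hcell, hheight⟩ := h.cell_lt_of_inversion hij hπ
  have hmod : ∀ k l : ℕ, 0 < M → k < l → k / M = l / M → k % M ≠ l % M := by
    intro k l hM hkl hdiv hmod
    have h1 := Nat.div_add_mod k M
    have h2 := Nat.div_add_mod l M
    rw [hdiv, hmod] at h1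
    omega
  rcases (h.isCell i).cases with ⟨q, hq, hi⟩ | ⟨k, hk, hi⟩ | ⟨k, hk, hi⟩
  · rcases (h.isCell j).cases with ⟨q', hq', hj⟩ | ⟨l, hl, hj⟩ | ⟨l, hl, hj⟩
    · have := h.blockIndex_lt_of_inversion hij hπ hi hj
      rw [hi, hj, cellColor_run, cellColor_run]
      omega
    · rw [hi, hj, cellColor_run, cellColor_low hl]
      unfold blockIndex
      omega
    · rw [hi, hj] at hheight
      exact absurd (run_lt_high hq l) hheight.not_gt
  · obtain ⟨l, hl, hj⟩ := h.low_of_lt hk hi hπ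
    have hM : 0 < M := Nat.pos_of_ne_zero fun h0 => by simp [h0] at hk
    have hkl : k < l := by omega
    rw [hi, hj] at hheight
    have hdiv : k / M = l / M := by
      refine (Nat.div_le_div_right hkl.le).antisymm (not_lt.mp fun hlt => ?_)
      exact absurd ((low_lt_low_iff hkl hl).mpr hlt) hheight.not_gt
    rw [hi, hj, cellColor_low hk, cellColor_low hl]
    have := hmod k l hM hkl hdiv
    omega
  · have hM : 0 < M := Nat.pos_of_ne_zero fun h0 => by simp [h0] at hk
    rcases (h.isCell j).cases with ⟨q', hq', hj⟩ | ⟨l, hl, hj⟩ | ⟨l, hl, hj⟩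
    · rw [hi, hj, cellColor_run, cellColor_high]
      have : blockIndex A M t q' = t := by unfold blockIndex; omega
      split_ifs <;> omega
    · omega
    · have hkl : k < l := by omega
      rw [hi, hj] at hheight
      have hdiv : k / M = l / M := by
        refine (Nat.div_le_div_right hkl.le).antisymm (not_lt.mp fun hlt => ?_)
        exact absurd ((high_lt_high_iff hkl hl).mpr hlt) hheight.not_gt
      rw [hi, hj, cellColor_high, cellColor_high]
      have := hmod k l hM hkl hdiv
      split_ifs <;> omega

theorem noLongDecreasing (h : IsCellPerm A B M t c π cell off) (ht : t ≤ M) :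
    NoLongDecreasing (M + 2) π := by
  intro S hS
  by_contra hcon
  obtain ⟨i, hi, j, hj, hij, he⟩ := Finset.exists_ne_map_eq_of_card_lt_of_maps_to
    (s := S) (t := Finset.range (M + 1)) (f := fun i => cellColor A M t (cell i))
    (by rw [Finset.card_range]; omega)
    (fun i _ => Finset.mem_coe.mpr (Finset.mem_range.mpr (h.cellColor_lt ht i)))
  rcases lt_or_gt_of_ne hij with hlt | hgt
  · exact h.cellColor_ne_of_inversion hlt (hS hi hj hlt) he
  · exact h.cellColor_ne_of_inversion hgt (hS hj hi hgt) he.symm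

theorem val_succ (h : IsCellPerm A B M t c π cell off) {i j : Fin n} (hc : cell i = cell j)
    (ho : off i + 1 = off j) : (i : ℕ) + 1 = j ∧ (π i : ℕ) + 1 = π j := by
  have hij : (i : ℕ) < j := (h.lt_iff i j).mpr (Or.inr ⟨hc, by omega⟩)
  have hπij : (π i : ℕ) < π j := (h.apply_lt_iff i j).mpr (Or.inr ⟨by rw [hc], by omega⟩)
  constructor
  · by_contra hne
    obtain ⟨k, hk⟩ : ∃ k : Fin n, (k : ℕ) = i + 1 := ⟨⟨i + 1, by omega⟩, rfl⟩
    have h1 := (h.lt_iff i k).mp (Fin.lt_def.mpr (by omega))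
    have h2 := (h.lt_iff k j).mp (Fin.lt_def.mpr (by omega))
    omega
  · by_contra hne
    have hbound : (π i : ℕ) + 1 < n := by omega
    obtain ⟨k, hk⟩ : ∃ k, (π k : ℕ) = π i + 1 := by
      obtain ⟨k, hk⟩ := π.surjective ⟨π i + 1, hbound⟩
      exact ⟨k, by rw [hk]⟩
    have h1 := (h.apply_lt_iff i k).mp (Fin.lt_def.mpr (by omega))
    have h2 := (h.apply_lt_iff k j).mp (Fin.lt_def.mpr (by omega))
    rw [hc] at h1
    omega

theorem isLongRunEnd (h : IsCellPerm A B M t c π cell off) {e : Fin n} {q : ℕ}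
    (he : cell e = 2 * q) (ho : off e + 1 = c) : IsLongRunEnd c π e := by
  constructor
  · intro r hr
    -- the `r`-th entry before the end is the entry number `c - 1 - r` of the cell
    obtain ⟨p, hp, hpo⟩ := h.exists_eq (2 * q) (c - 1 - r) (he ▸ h.isCell e) (by omega) (by omega)
    have key : ∀ (s : ℕ) (u : Fin n), s < c → cell u = 2 * q → off u + s + 1 = c →
        (u : ℕ) + s = e ∧ (π u : ℕ) + s = π e := by
      intro s
      induction s with
      | zero =>
        intro u _ hu huo
        have : u = e := by
          rcases lt_trichotomy u e with hlt | heq | hgt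
          · have := (h.lt_iff u e).mp hlt; omega
          · exact heq
          · have := (h.lt_iff e u).mp hgt; omega
        rw [this]
        simp
      | succ s ih =>
        intro u hs hu huo
        obtain ⟨w, hw, hwo⟩ := h.exists_eq (2 * q) (off u + 1) (hu ▸ h.isCell u) (by omega)
          (by omega)
        have h1 := h.val_succ (hu.trans hw.symm) hwo.symm
        have h2 := ih w (by omega) hw (by omega)
        omega
    exact ⟨p, key r p hr hp (by omega)⟩
  · intro e' he' hval
    have hlt : e < e' := Fin.lt_def.mpr (by omega)
    have hπlt : π e < π e' := Fin.lt_def.mpr (by omega)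
    have hoff := h.off_lt e'
    have hD : numGaps A B M t = A * M + t + B * M := rfl
    have hcell : 2 * q < cell e' := by
      rcases (h.lt_iff e e').mp hlt with h1 | h1 <;> omega
    have hq : q + 1 ≤ numGaps A B M t := by
      have := (h.isCell e').1
      rcases (h.isCell e').cases with ⟨q', hq', he'⟩ | ⟨l, hl, he'⟩ | ⟨l, hl, he'⟩ <;> omega
    -- the next cell to the right starts at `e'`
    have hnext : ∀ x, IsCell A B M t x → 2 * q < x → cell e' ≤ x := by
      intro x hx hqx
      obtain ⟨w, hw, hwo⟩ := h.exists_eq x 0 hx (by omega) (by omega)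
      have hew : (e : ℕ) < w := (h.lt_iff e w).mpr (Or.inl (by omega))
      by_contra hcon
      have : (w : ℕ) < e' := (h.lt_iff w e').mpr (Or.inl (by omega))
      omega
    have hv := h.height_le hπlt
    by_cases hlow : q < A * M
    · have h1 : cell e' = 2 * q + 1 := by
        have := hnext _ (isCell_low hlow) (by omega)
        omega
      rw [he, h1] at hv
      exact absurd (low_lt_run hlow q) hv.not_gt
    · by_cases hmid : q < A * M + t
      · have h1 : cell e' = 2 * (q + 1) := by
          have h2 := hnext _ (isCell_run hq) (by omega)
          rcases (h.isCell e').cases with ⟨q', hq', he'⟩ | ⟨l, hl, he'⟩ | ⟨l, hl, he'⟩ <;> omega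
        rw [he, h1] at hv
        exact absurd (run_lt_run_of_lt hq (by unfold blockIndex; omega)) hv.not_gt
      · obtain ⟨i, hi⟩ : ∃ i, q = A * M + t + i := ⟨q - (A * M + t), by omega⟩
        have h1 : cell e' = 2 * q + 1 := by
          have := hnext _ (isCell_high (i := i) (by omega)) (by omega)
          omega
        -- the value of the next run lies between
        obtain ⟨w, hw, hwo⟩ := h.exists_eq (2 * (q + 1)) 0 (isCell_run hq) (by omega) (by omega)
        have h2 : (π e : ℕ) < π w := (h.apply_lt_iff e w).mpr (Or.inl (by
          rw [he, hw]
          exact run_lt_run_of_eq (by omega) (by unfold blockIndex; omega)))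
        have h3 : (π w : ℕ) < π e' := (h.apply_lt_iff w e').mpr (Or.inl (by
          rw [hw, h1, hi]
          exact run_lt_high (by omega) i))
        omega

end IsCellPerm

/-- There is a permutation in the class with `(a + b - 2) * (m - 2) + 1` long runs. -/
theorem exists_perm_with_long_runs {a b m : ℕ} (ha : 1 ≤ a) (hab : 2 ≤ a + b) (hm : 2 ≤ m) {c : ℕ}
    (hc : 1 ≤ c) : ∃ (n : ℕ) (π : Equiv.Perm (Fin n)), NoLeftShift a b π ∧ NoRightShift a b π ∧
      NoLongDecreasing m π ∧ ∃ E : Finset (Fin n), E.card = (a + b - 2) * (m - 2) + 1 ∧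
        ∀ e ∈ E, IsLongRunEnd c π e := by
  obtain ⟨M, rfl⟩ : ∃ M, m = M + 2 := ⟨m - 2, by omega⟩
  rw [show M + 2 - 2 = M by omega]
  obtain ⟨A, B, t, hA, hB, hb, ha', ht, hD⟩ : ∃ A B t : ℕ, A ≤ a - 2 ∧ B ≤ b - 1 ∧
      (b = 0 → t = 0) ∧ (a ≤ 1 → t = 0) ∧ t ≤ M ∧ numGaps A B M t = (a + b - 2) * M := by
    by_cases h : a ≤ 1 ∨ b = 0
    · refine ⟨a - 2, b - 1, 0, le_rfl, le_rfl, fun _ => rfl, fun _ => rfl, Nat.zero_le _, ?_⟩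
      rw [numGaps, Nat.add_zero, ← Nat.add_mul]
      congr 1
      omega
    · refine ⟨a - 2, b - 1, M, le_rfl, le_rfl, fun _ => by omega, fun _ => by omega, le_rfl, ?_⟩
      rw [numGaps, ← Nat.succ_mul, ← Nat.add_mul]
      congr 1
      omega
  obtain ⟨n, π, cell, off, h⟩ := exists_isCellPerm A B M t c
  refine ⟨n, π, h.noLeftShift hA hB hb, h.noRightShift hA hB ha', h.noLongDecreasing ht, ?_⟩
  have hex : ∀ q : Fin (numGaps A B M t + 1), ∃ e : Fin n, cell e = 2 * q ∧ off e = c - 1 :=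
    fun q => h.exists_eq _ _ (isCell_run (by omega)) (by omega) (by omega)
  choose e he ho using hex
  have hinj : Function.Injective e := fun q q' hqq' => by
    have h1 := he q
    have h2 := he q'
    rw [hqq'] at h1
    exact Fin.ext (by omega)
  refine ⟨Finset.univ.map ⟨e, hinj⟩, by simp [hD], fun x hx => ?_⟩
  obtain ⟨q, -, rfl⟩ := Finset.mem_map.mp hx
  have := ho q
  exact h.isLongRunEnd (he q) (show off (e q) + 1 = c by omega)

end Construction

/-! ### Inflations by increasing runs -/

section Inflation

/-- `π` is the inflation of `σ` in which the entry at position `i` is replaced by a run of `t i`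
consecutive integers in increasing order; the position `j` of `π` belongs to the run `f j`. -/
structure IsInflation {l n : ℕ} (σ : Equiv.Perm (Fin l)) (t : Fin l → ℕ) (π : Equiv.Perm (Fin n))
    (f : Fin n → Fin l) : Prop where
  monotone : Monotone f
  card_fiber : ∀ i, (Finset.univ.filter fun j => f j = i).card = t i
  lt_iff : ∀ j j', π j < π j' ↔ σ (f j) < σ (f j') ∨ f j = f j' ∧ j < j'

/-- No two adjacent entries of `σ` are consecutive integers in increasing order: the runs of an
inflation of `σ` are maximal. -/
def RunFree {l : ℕ} (σ : Equiv.Perm (Fin l)) : Prop :=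
  ∀ i i' : Fin l, (i' : ℕ) = i + 1 → (σ i' : ℕ) ≠ σ i + 1

theorem exists_isInflation {l n : ℕ} (σ : Equiv.Perm (Fin l)) (t : Fin l → ℕ)
    (ht : ∑ i, t i = n) : ∃ (π : Equiv.Perm (Fin n)) (f : Fin n → Fin l), IsInflation σ t π f := by
  have hcard : Fintype.card (Σₗ i : Fin l, Fin (t i)) = n := by
    rw [← ht]
    exact (Fintype.card_sigma (α := fun i => Fin (t i))).trans (by simp)
  let iso : Fin n ≃o Σₗ i : Fin l, Fin (t i) := Fintype.orderIsoFinOfCardEq _ hcard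
  let f : Fin n → Fin l := fun j => (ofLex (iso j)).1
  have hf : Monotone f := by
    intro j j' hjj'
    have h := Sigma.lex_iff.mp (iso.monotone hjj')
    rcases h with h | ⟨h, -⟩
    · exact h.le
    · exact h.le
  let key : Fin n → Fin l ×ₗ Fin n := fun j => toLex (σ (f j), j)
  have hkey : Function.Injective key := fun j j' h => (Prod.ext_iff.mp (toLex.injective h)).2
  obtain ⟨π, hπ⟩ := exists_perm_of_key key hkey
  refine ⟨π, f, hf, fun i => ?_, fun j j' => ?_⟩
  · have : t i = (Finset.univ : Finset (Fin (t i))).card := by simp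
    rw [this]
    symm
    refine Finset.card_bij (fun x _ => iso.symm (toLex ⟨i, x⟩)) ?_ ?_ ?_
    · intro x _
      simp [f]
    · intro x _ y _ h
      have := toLex.injective (iso.symm.injective h)
      simpa using this
    · intro j hj
      have hj' : f j = i := (Finset.mem_filter.mp hj).2
      subst hj'
      exact ⟨(ofLex (iso j)).2, Finset.mem_univ _, iso.symm_apply_apply j⟩
  · rw [hπ, Prod.Lex.lt_iff]
    simp [key]

/-- Two permutations with the same inversions are equal. -/
theorem perm_eq_of_lt_iff {n : ℕ} {π π' : Equiv.Perm (Fin n)}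
    (h : ∀ i j, π i < π j ↔ π' i < π' j) : π = π' := by
  have hs : StrictMono (π' * π⁻¹) := by
    intro u v huv
    have := (h (π⁻¹ u) (π⁻¹ v)).mp (by simpa using huv)
    simpa using this
  have := strictMono_perm_eq_one hs
  exact (mul_inv_eq_one.mp this).symm

theorem eq_of_monotone_of_card_fiber {l n : ℕ} {f g : Fin n → Fin l} (hf : Monotone f)
    (hg : Monotone g) (h : ∀ i, (Finset.univ.filter fun j => f j = i).card =
      (Finset.univ.filter fun j => g j = i).card) : f = g := by
  have key : ∀ i, (Finset.univ.filter fun j => f j ≤ i) = Finset.univ.filter fun j => g j ≤ i := by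
    intro i
    have hc : ∀ k : Fin n → Fin l, (Finset.univ.filter fun j => k j ≤ i).card =
        ∑ i' ∈ Finset.Iic i, (Finset.univ.filter fun j => k j = i').card := by
      intro k
      rw [Finset.card_eq_sum_card_fiberwise (f := k) (t := Finset.Iic i)]
      · refine Finset.sum_congr rfl fun i' hi' => ?_
        rw [Finset.filter_filter]
        congr 1
        ext j
        simp only [Finset.mem_filter, Finset.mem_univ, true_and, and_iff_right_iff_imp]
        rintro rfl
        exact Finset.mem_Iic.mp hi'
      · intro j hj
        simpa using hj
    have hcard : (Finset.univ.filter fun j => f j ≤ i).card =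
        (Finset.univ.filter fun j => g j ≤ i).card := by
      rw [hc f, hc g]
      exact Finset.sum_congr rfl fun i' _ => h i'
    have hlow : ∀ k : Fin n → Fin l, Monotone k → IsLowerSet {j | k j ≤ i} :=
      fun k hk x y hyx hx => (hk hyx).trans hx
    rcases (hlow f hf).total (hlow g hg) with hsub | hsub
    · exact Finset.eq_of_subset_of_card_le (fun j hj => by simpa using hsub (by simpa using hj))
        hcard.ge
    · exact (Finset.eq_of_subset_of_card_le (fun j hj => by simpa using hsub (by simpa using hj))
        hcard.le).symm
  ext j
  have h1 : f j ≤ g j := by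
    have : j ∈ Finset.univ.filter fun j' => g j' ≤ g j := by simp
    rw [← key] at this
    simpa using this
  have h2 : g j ≤ f j := by
    have : j ∈ Finset.univ.filter fun j' => f j' ≤ f j := by simp
    rw [key] at this
    simpa using this
  exact congrArg Fin.val (le_antisymm h1 h2)

namespace IsInflation

variable {l n : ℕ} {σ : Equiv.Perm (Fin l)} {t : Fin l → ℕ} {π : Equiv.Perm (Fin n)}
  {f : Fin n → Fin l}

theorem sum_eq (h : IsInflation σ t π f) : ∑ i, t i = n := by
  have := Finset.card_eq_sum_card_fiberwise (f := f) (s := Finset.univ) (t := Finset.univ)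
    (fun _ _ => Finset.mem_coe.mpr (Finset.mem_univ _))
  rw [Finset.card_univ, Fintype.card_fin] at this
  rw [this]
  exact Finset.sum_congr rfl fun i _ => (h.card_fiber i).symm

theorem perm_unique {π' : Equiv.Perm (Fin n)} {f' : Fin n → Fin l} (h : IsInflation σ t π f)
    (h' : IsInflation σ t π' f') : π = π' := by
  have hff' : f = f' := eq_of_monotone_of_card_fiber h.monotone h'.monotone fun i => by
    rw [h.card_fiber, h'.card_fiber]
  subst hff'
  exact perm_eq_of_lt_iff fun i j => (h.lt_iff i j).trans (h'.lt_iff i j).symm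

theorem surjective (h : IsInflation σ t π f) (ht : ∀ i, 0 < t i) : Function.Surjective f := by
  intro i
  have := ht i
  rw [← h.card_fiber i] at this
  obtain ⟨j, hj⟩ := Finset.card_pos.mp this
  exact ⟨j, (Finset.mem_filter.mp hj).2⟩

theorem sigma_le (h : IsInflation σ t π f) {j k : Fin n} (hjk : π j < π k) :
    σ (f j) ≤ σ (f k) := by
  rcases (h.lt_iff j k).mp hjk with h1 | h1
  · exact h1.le
  · rw [h1.1]

theorem val_succ (h : IsInflation σ t π f) {j j' : Fin n} (hj : (j' : ℕ) = j + 1)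
    (hf : f j = f j') : (π j' : ℕ) = π j + 1 := by
  have hlt : (π j : ℕ) < π j' := (h.lt_iff j j').mpr (Or.inr ⟨hf, Fin.lt_def.mpr (by omega)⟩)
  by_contra hne
  have hb : (π j : ℕ) + 1 < n := by omega
  obtain ⟨k, hk⟩ : ∃ k, (π k : ℕ) = π j + 1 := by
    obtain ⟨k, hk⟩ := π.surjective ⟨π j + 1, hb⟩
    exact ⟨k, by rw [hk]⟩
  have h1 : π j < π k := Fin.lt_def.mpr (by omega)
  have h2 : π k < π j' := Fin.lt_def.mpr (by omega)
  have hfk : f k = f j := by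
    have h3 := h.sigma_le h1
    have h4 := h.sigma_le h2
    rw [← hf] at h4
    exact σ.injective (le_antisymm h4 h3)
  have h5 : (j : ℕ) < k := by
    rcases (h.lt_iff j k).mp h1 with h5 | h5
    · rw [hfk] at h5
      exact absurd h5 (lt_irrefl _)
    · exact h5.2
  have h6 : (k : ℕ) < j' := by
    rcases (h.lt_iff k j').mp h2 with h6 | h6
    · rw [hfk, hf] at h6
      exact absurd h6 (lt_irrefl _)
    · exact h6.2
  omega

theorem fiber_succ (h : IsInflation σ t π f) (ht : ∀ i, 0 < t i) {j j' : Fin n}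
    (hj : (j' : ℕ) = j + 1) : (f j' : ℕ) = f j ∨ (f j' : ℕ) = f j + 1 := by
  have hle : (f j : ℕ) ≤ f j' := h.monotone (Fin.le_def.mpr (by omega))
  by_contra hcon
  obtain ⟨k, hk⟩ := h.surjective ht ⟨f j + 1, by have := (f j').2; omega⟩
  have hk' : (f k : ℕ) = f j + 1 := by rw [hk]
  rcases le_or_gt k j with hkj | hkj
  · have : (f k : ℕ) ≤ f j := h.monotone hkj
    omega
  · have : (f j' : ℕ) ≤ f k := h.monotone (Fin.le_def.mpr (by have : (j : ℕ) < k := hkj; omega))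
    omega

theorem same_fiber (h : IsInflation σ t π f) (ht : ∀ i, 0 < t i) (hσ : RunFree σ) {j j' : Fin n}
    (hj : (j' : ℕ) = j + 1) (hπ : (π j' : ℕ) = π j + 1) : f j = f j' := by
  rcases h.fiber_succ ht hj with h1 | h1
  · exact (Fin.ext h1).symm
  exfalso
  have hne : f j ≠ f j' := fun he => by rw [he] at h1; omega
  have hσne : σ (f j) ≠ σ (f j') := fun he => hne (σ.injective he)
  have hlt : (σ (f j) : ℕ) < σ (f j') := by
    have : σ (f j) ≤ σ (f j') := h.sigma_le (Fin.lt_def.mpr (by omega))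
    exact this.lt_of_ne hσne
  have hns := hσ (f j) (f j') h1
  have hb : (σ (f j) : ℕ) + 1 < l := by omega
  obtain ⟨i, hi⟩ : ∃ i, (σ i : ℕ) = σ (f j) + 1 := by
    obtain ⟨i, hi⟩ := σ.surjective ⟨σ (f j) + 1, hb⟩
    exact ⟨i, by rw [hi]⟩
  obtain ⟨k, rfl⟩ := h.surjective ht i
  have h2 : (π j : ℕ) < π k := (h.lt_iff j k).mpr (Or.inl (Fin.lt_def.mpr (by omega)))
  have h3 : (π k : ℕ) < π j' := (h.lt_iff k j').mpr (Or.inl (Fin.lt_def.mpr (by omega)))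
  omega

theorem val_add (h : IsInflation σ t π f) {j j' : Fin n} (d : ℕ) (hj : (j' : ℕ) = j + d)
    (hf : f j = f j') : (π j' : ℕ) = π j + d := by
  induction d generalizing j' with
  | zero => rw [show j' = j from Fin.ext hj]; rfl
  | succ d ih =>
    obtain ⟨k, hk⟩ : ∃ k : Fin n, (k : ℕ) = j + d := ⟨⟨j + d, by omega⟩, rfl⟩
    have h1 : f j ≤ f k := h.monotone (Fin.le_def.mpr (by omega))
    have h2 : f k ≤ f j' := h.monotone (Fin.le_def.mpr (by omega))
    rw [← hf] at h2
    have h3 : f j = f k := le_antisymm h1 h2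
    have := ih hk h3
    have := h.val_succ (j := k) (j' := j') (by omega) (h3.symm.trans hf)
    omega

open Classical in
/-- In an inflation of a run-free permutation, the number of the run of a position is the number of
breaks before it. -/
theorem val_eq_card_breaks (h : IsInflation σ t π f) (ht : ∀ i, 0 < t i) (hσ : RunFree σ)
    (j : Fin n) : (f j : ℕ) = (Finset.univ.filter fun e => IsBreak π e ∧ e < j).card := by
  obtain ⟨k, hk⟩ := j
  induction k with
  | zero =>
    have h0 : (Finset.univ.filter fun e : Fin n => IsBreak π e ∧ e < ⟨0, hk⟩) = ∅ :=
      Finset.filter_eq_empty_iff.mpr fun e _ he => absurd (Fin.lt_def.mp he.2) (Nat.not_lt_zero _)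
    rw [h0, Finset.card_empty]
    obtain ⟨u, hu⟩ := h.surjective ht ⟨0, (Nat.zero_le _).trans_lt (f ⟨0, hk⟩).2⟩
    have : (f ⟨0, hk⟩ : ℕ) ≤ f u := h.monotone (Fin.le_def.mpr (Nat.zero_le _))
    rw [hu] at this
    exact Nat.le_zero.mp this
  | succ k ih =>
    have hk' : k < n := by omega
    specialize ih hk'
    have hstep := h.fiber_succ ht (j := ⟨k, hk'⟩) (j' := ⟨k + 1, hk⟩) rfl
    by_cases hb : IsBreak π ⟨k, hk'⟩
    · have : (Finset.univ.filter fun e : Fin n => IsBreak π e ∧ e < ⟨k + 1, hk⟩) =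
          insert ⟨k, hk'⟩ (Finset.univ.filter fun e : Fin n => IsBreak π e ∧ e < ⟨k, hk'⟩) := by
        ext e
        simp only [Finset.mem_filter, Finset.mem_univ, true_and, Finset.mem_insert, Fin.lt_def,
          Fin.ext_iff]
        constructor
        · rintro ⟨h1, h2⟩
          by_cases he : (e : ℕ) = k
          · exact Or.inl he
          · exact Or.inr ⟨h1, by omega⟩
        · rintro (h1 | h1)
          · exact ⟨(Fin.ext h1 : e = ⟨k, hk'⟩) ▸ hb, by omega⟩
          · exact ⟨h1.1, by omega⟩
      rw [this, Finset.card_insert_of_notMem (by simp), ← ih]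
      refine hstep.resolve_left fun he => ?_
      obtain ⟨e', he', hv⟩ := hb
      have : e' = ⟨k + 1, hk⟩ := Fin.ext he'
      subst this
      exact hv (h.val_succ he' (Fin.ext he).symm)
    · have : (Finset.univ.filter fun e : Fin n => IsBreak π e ∧ e < ⟨k + 1, hk⟩) =
          Finset.univ.filter fun e : Fin n => IsBreak π e ∧ e < ⟨k, hk'⟩ := by
        ext e
        simp only [Finset.mem_filter, Finset.mem_univ, true_and, Fin.lt_def]
        refine ⟨fun ⟨h1, h2⟩ => ⟨h1, ?_⟩, fun ⟨h1, h2⟩ => ⟨h1, by omega⟩⟩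
        have : (e : ℕ) ≠ k := fun he => hb ((Fin.ext he : e = ⟨k, hk'⟩) ▸ h1)
        omega
      rw [this, ← ih]
      have hv : (π ⟨k + 1, hk⟩ : ℕ) = π ⟨k, hk'⟩ + 1 := by
        by_contra hv
        exact hb ⟨_, rfl, hv⟩
      rw [h.same_fiber ht hσ (j := ⟨k, hk'⟩) (j' := ⟨k + 1, hk⟩) rfl hv]

/-- A permutation is an inflation of a run-free permutation in only one way. -/
theorem data_unique {l' : ℕ} {σ' : Equiv.Perm (Fin l')} {t' : Fin l' → ℕ} {f' : Fin n → Fin l'}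
    (h : IsInflation σ t π f) (h' : IsInflation σ' t' π f') (ht : ∀ i, 0 < t i)
    (ht' : ∀ i, 0 < t' i) (hσ : RunFree σ) (hσ' : RunFree σ') :
    (⟨l, σ, t⟩ : Σ l, Equiv.Perm (Fin l) × (Fin l → ℕ)) = ⟨l', σ', t'⟩ := by
  have hff' : ∀ j, (f j : ℕ) = f' j := fun j => by
    rw [h.val_eq_card_breaks ht hσ, h'.val_eq_card_breaks ht' hσ']
  have hl : l = l' := by
    rcases lt_trichotomy l l' with hlt | heq | hgt
    · obtain ⟨j, hj⟩ := h'.surjective ht' ⟨l, hlt⟩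
      have h1 := hff' j
      rw [hj] at h1
      exact absurd h1 (f j).2.ne
    · exact heq
    · obtain ⟨j, hj⟩ := h.surjective ht ⟨l', hgt⟩
      have h1 := hff' j
      rw [hj] at h1
      exact absurd h1.symm (f' j).2.ne
  subst hl
  have hf : f = f' := funext fun j => Fin.ext (hff' j)
  subst hf
  have hσσ' : σ = σ' := by
    refine perm_eq_of_lt_iff fun i i' => ?_
    by_cases hii' : i = i'
    · subst hii'
      simp
    obtain ⟨j, rfl⟩ := h.surjective ht i
    obtain ⟨j', rfl⟩ := h.surjective ht i'
    have h1 := h.lt_iff j j'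
    have h2 := h'.lt_iff j j'
    simp only [hii', false_and, or_false] at h1 h2
    exact h1.symm.trans h2
  have htt' : t = t' := funext fun i => (h.card_fiber i).symm.trans (h'.card_fiber i)
  rw [hσσ', htt']

/-- Whether an inflation contains a pattern of size at most `c` depends only on the lengths of the
runs truncated at `c`. -/
theorem contains_of_min_le {c k n' : ℕ} {t' : Fin l → ℕ} {π' : Equiv.Perm (Fin n')}
    {f' : Fin n' → Fin l} (h : IsInflation σ t π f) (h' : IsInflation σ t' π' f')
    (hmin : ∀ i, min (t i) c ≤ t' i) (hk : k ≤ c) {ρ : Equiv.Perm (Fin k)} (hc : Contains π ρ) :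
    Contains π' ρ := by
  obtain ⟨g, hg, hord⟩ := hc
  -- the entries used in each run are moved to the beginning of the corresponding run of `π'`
  let rank : Fin k → ℕ := fun x => (Finset.univ.filter fun y => f (g y) = f (g x) ∧ y < x).card
  have hrank : ∀ x, rank x < t' (f (g x)) := by
    intro x
    have hlt : rank x < (Finset.univ.filter fun y => f (g y) = f (g x)).card := by
      refine Finset.card_lt_card ⟨fun y hy => ?_, fun hsub => ?_⟩
      · simp only [Finset.mem_filter, Finset.mem_univ, true_and] at hy ⊢
        exact hy.1
      · have := hsub (show x ∈ _ by simp)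
        simp at this
    have h1 : (Finset.univ.filter fun y => f (g y) = f (g x)).card ≤ k := by
      simpa using Finset.card_le_univ (Finset.univ.filter fun y => f (g y) = f (g x))
    have h2 : (Finset.univ.filter fun y => f (g y) = f (g x)).card ≤ t (f (g x)) := by
      rw [← h.card_fiber]
      refine Finset.card_le_card_of_injOn g (fun y hy => ?_) hg.injective.injOn
      simpa using hy
    have := hmin (f (g x))
    omega
  let g' : Fin k → Fin n' := fun x =>
    (Finset.univ.filter fun j => f' j = f (g x)).orderEmbOfFin (h'.card_fiber _)
      ⟨rank x, hrank x⟩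
  have hf' : ∀ x, f' (g' x) = f (g x) := fun x =>
    (Finset.mem_filter.mp (Finset.orderEmbOfFin_mem _ (h'.card_fiber (f (g x))) _)).2
  have hemb : ∀ (i : Fin l) (r s : ℕ) (hr : r < t' i) (hs : s < t' i), r < s →
      (Finset.univ.filter fun j => f' j = i).orderEmbOfFin (h'.card_fiber i) ⟨r, hr⟩ <
        (Finset.univ.filter fun j => f' j = i).orderEmbOfFin (h'.card_fiber i) ⟨s, hs⟩ :=
    fun i r s hr hs hrs => (OrderEmbedding.lt_iff_lt _).mpr hrs
  have hg' : StrictMono g' := by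
    intro x y hxy
    rcases (h.monotone (hg hxy).le).lt_or_eq with hlt | heq
    · by_contra hle
      have := h'.monotone (not_lt.mp hle)
      rw [hf', hf'] at this
      exact absurd hlt this.not_gt
    · have hr : rank x < rank y := by
        refine Finset.card_lt_card ⟨fun u hu => ?_, fun hsub => ?_⟩
        · simp only [Finset.mem_filter, Finset.mem_univ, true_and] at hu ⊢
          exact ⟨hu.1.trans heq, hu.2.trans hxy⟩
        · have := hsub (show x ∈ _ by simp [heq, hxy])
          simp at this
      have key : ∀ (i : Fin l) (hi : f (g x) = i), g' x =
          (Finset.univ.filter fun j => f' j = i).orderEmbOfFin (h'.card_fiber i)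
            ⟨rank x, hi ▸ hrank x⟩ := by
        rintro i rfl
        rfl
      rw [key _ heq]
      exact hemb _ _ _ _ _ hr
  refine ⟨g', hg', fun x y => ?_⟩
  rw [← hord, h.lt_iff, h'.lt_iff, hf', hf', hg'.lt_iff_lt, hg.lt_iff_lt]

theorem exists_isLongRunEnd {c : ℕ} (h : IsInflation σ t π f) (ht : ∀ i, 0 < t i)
    (hσ : RunFree σ) (i : Fin l) (hi : c ≤ t i) : ∃ e, f e = i ∧ IsLongRunEnd c π e := by
  have hne : (Finset.univ.filter fun j => f j = i).Nonempty :=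
    Finset.card_pos.mp (by rw [h.card_fiber]; exact ht i)
  set e := (Finset.univ.filter fun j => f j = i).max' hne with he
  have hei : f e = i := (Finset.mem_filter.mp (Finset.max'_mem _ hne)).2
  have hmax : ∀ j, f j = i → j ≤ e := fun j hj => Finset.le_max' _ _ (by simpa using hj)
  refine ⟨e, hei, fun r hr => ?_, fun e' he' hv => ?_⟩
  · -- otherwise the run would be contained in the interval `(e - r, e]`
    obtain ⟨j, hj, hjr⟩ : ∃ j, f j = i ∧ (j : ℕ) + r ≤ e := by
      by_contra hcon
      push Not at hcon
      have hsub : (Finset.univ.filter fun j => f j = i).map Fin.valEmbedding ⊆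
          Finset.Ioc ((e : ℕ) - r) e := by
        intro v hv
        obtain ⟨j, hj, rfl⟩ := Finset.mem_map.mp hv
        have hj' := (Finset.mem_filter.mp hj).2
        have h1 := hcon j hj'
        have h2 : (j : ℕ) ≤ e := hmax j hj'
        rw [Finset.mem_Ioc, Fin.valEmbedding_apply]
        rcases Nat.lt_or_ge (e : ℕ) r with h3 | h3
        · exfalso
          have hcard := Finset.card_le_card
            (show (Finset.univ.filter fun j => f j = i).map Fin.valEmbedding ⊆
              Finset.Iic (e : ℕ) from fun v hv => by
                obtain ⟨u, hu, rfl⟩ := Finset.mem_map.mp hv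
                exact Finset.mem_Iic.mpr (hmax u (Finset.mem_filter.mp hu).2))
          rw [Finset.card_map, h.card_fiber, Nat.card_Iic] at hcard
          omega
        · omega
      have hcard := Finset.card_le_card hsub
      rw [Finset.card_map, h.card_fiber, Nat.card_Ioc] at hcard
      omega
    obtain ⟨p, hp⟩ : ∃ p : Fin n, (p : ℕ) + r = e := ⟨⟨e - r, by omega⟩, by simp; omega⟩
    have hpi : f p = i := le_antisymm
      (hei ▸ h.monotone (Fin.le_def.mpr (by omega))) (hj ▸ h.monotone (Fin.le_def.mpr (by omega)))
    exact ⟨p, hp, (h.val_add r hp.symm (hpi.trans hei.symm)).symm⟩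
  · have := h.same_fiber ht hσ he' hv
    have : (e' : ℕ) ≤ e := hmax e' (this.symm.trans hei)
    omega

theorem le_of_isLongRunEnd {c : ℕ} (h : IsInflation σ t π f) (ht : ∀ i, 0 < t i)
    (hσ : RunFree σ) {e : Fin n} (he : IsLongRunEnd c π e) : c ≤ t (f e) := by
  choose p hp hpv using he.1
  have hfp : ∀ r (hr : r < c), f (p r hr) = f e := by
    intro r
    induction r with
    | zero =>
      intro hr
      rw [show p 0 hr = e from Fin.ext (hp 0 hr)]
    | succ r ih =>
      intro hr
      have hr' : r < c := by omega
      rw [← ih hr']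
      have := hp _ hr
      have := hp _ hr'
      have := hpv _ hr
      have := hpv _ hr'
      exact h.same_fiber ht hσ (by omega) (by omega)
  rw [← h.card_fiber]
  have hcard := Finset.card_le_card_of_injOn (s := (Finset.univ : Finset (Fin c)))
    (t := Finset.univ.filter fun j => f j = f e) (fun r => p r r.2)
    (fun r _ => by simpa using hfp r r.2) (fun r _ s _ hrs => by
      have h1 := hp r r.2
      have h2 := hp s s.2
      have h3 : (p r r.2 : ℕ) = p s s.2 := congrArg Fin.val hrs
      exact Fin.ext (by omega))
  simpa using hcard

theorem injOn_isLongRunEnd {c : ℕ} (h : IsInflation σ t π f) :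
    Set.InjOn f {e | IsLongRunEnd c π e} := by
  have key : ∀ e e', IsLongRunEnd c π e → e < e' → f e ≠ f e' := by
    intro e e' he hlt heq
    have hlt' : (e : ℕ) < e' := hlt
    obtain ⟨s, hs⟩ : ∃ s : Fin n, (s : ℕ) = e + 1 := ⟨⟨e + 1, by omega⟩, rfl⟩
    have h1 : f e ≤ f s := h.monotone (Fin.le_def.mpr (by omega))
    have h2 : f s ≤ f e' := h.monotone (Fin.le_def.mpr (by omega))
    rw [← heq] at h2
    exact he.2 s hs (h.val_succ hs (le_antisymm h1 h2))
  intro e he e' he' heq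
  rcases lt_trichotomy e e' with hlt | h' | hgt
  · exact absurd heq (key e e' he hlt)
  · exact h'
  · exact absurd heq.symm (key e' e he' hgt)

end IsInflation

open Classical in
/-- Every permutation is an inflation of a run-free permutation, with one run more than it has
breaks. -/
theorem exists_runFree_isInflation {n : ℕ} (hn : 0 < n) (π : Equiv.Perm (Fin n)) :
    ∃ (l : ℕ) (σ : Equiv.Perm (Fin l)) (t : Fin l → ℕ) (f : Fin n → Fin l),
      l = (Finset.univ.filter (IsBreak π)).card + 1 ∧ RunFree σ ∧ (∀ i, 0 < t i) ∧
        IsInflation σ t π f := by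
  let F : Fin n → ℕ := fun j => (Finset.univ.filter fun e => IsBreak π e ∧ e < j).card
  have hmono : ∀ j j', j ≤ j' → F j ≤ F j' := fun j j' hjj' =>
    Finset.card_le_card fun e he => by
      simp only [Finset.mem_filter, Finset.mem_univ, true_and] at he ⊢
      exact ⟨he.1, he.2.trans_le hjj'⟩
  have hlt : ∀ j j', j < j' → IsBreak π j → F j < F j' := fun j j' hjj' hj =>
    Finset.card_lt_card ⟨fun e he => by
      simp only [Finset.mem_filter, Finset.mem_univ, true_and] at he ⊢
      exact ⟨he.1, he.2.trans hjj'⟩, fun hsub => by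
      have := hsub (show j ∈ _ by simp [hj, hjj'])
      simp at this⟩
  have hstep : ∀ j j' : Fin n, (j' : ℕ) = j + 1 → F j' ≤ F j + 1 := by
    intro j j' hj
    have hsub : (Finset.univ.filter fun e => IsBreak π e ∧ e < j') ⊆
        insert j (Finset.univ.filter fun e => IsBreak π e ∧ e < j) := by
      intro e he
      simp only [Finset.mem_filter, Finset.mem_univ, true_and, Finset.mem_insert, Fin.lt_def,
        Fin.ext_iff] at he ⊢
      by_cases hej : (e : ℕ) = j
      · exact Or.inl hej
      · exact Or.inr ⟨he.1, by omega⟩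
    exact (Finset.card_le_card hsub).trans (Finset.card_insert_le _ _)
  have hzero : F ⟨0, hn⟩ = 0 := Finset.card_eq_zero.mpr (Finset.filter_eq_empty_iff.mpr
    fun e _ he => absurd (Fin.lt_def.mp he.2) (Nat.not_lt_zero _))
  have hlast : F ⟨n - 1, by omega⟩ = (Finset.univ.filter (IsBreak π)).card := by
    refine congrArg Finset.card (Finset.filter_congr fun e _ => ?_)
    refine ⟨fun h => h.1, fun h => ⟨h, Fin.lt_def.mpr ?_⟩⟩
    obtain ⟨e', he', -⟩ := h
    have := e'.2
    simp only
    omega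
  -- every value from `1` to that at the last position is attained just after a break
  have hattain : ∀ (k : ℕ) (hk : k < n) (i : ℕ), i + 1 ≤ F ⟨k, hk⟩ →
      ∃ e e' : Fin n, (e' : ℕ) = e + 1 ∧ F e = i ∧ F e' = i + 1 := by
    intro k
    induction k with
    | zero => intro hk i hi; rw [hzero] at hi; omega
    | succ k ih =>
      intro hk i hi
      by_cases hle : i + 1 ≤ F ⟨k, by omega⟩
      · exact ih (by omega) i hle
      · have := hstep ⟨k, by omega⟩ ⟨k + 1, hk⟩ rfl
        exact ⟨⟨k, by omega⟩, ⟨k + 1, hk⟩, rfl, by omega, by omega⟩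
  let l := (Finset.univ.filter (IsBreak π)).card + 1
  have hFl : ∀ j, F j < l := fun j => by
    have := hmono j ⟨n - 1, by omega⟩ (Fin.le_def.mpr (by have := j.2; simp only; omega))
    simp only [l]
    omega
  let f : Fin n → Fin l := fun j => ⟨F j, hFl j⟩
  have hsurj : Function.Surjective f := by
    rintro ⟨i, hi⟩
    rcases i with _ | i
    · exact ⟨⟨0, hn⟩, Fin.ext hzero⟩
    · obtain ⟨e, e', -, -, he'⟩ := hattain (n - 1) (by omega) i (by
        rw [hlast]
        simp only [l] at hi
        omega)
      exact ⟨e', Fin.ext he'⟩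
  have hfmono : Monotone f := fun j j' h => Fin.le_def.mpr (hmono j j' h)
  -- inside a run the entries are consecutive
  have hrun : ∀ (d : ℕ) (j j' : Fin n), (j' : ℕ) = j + d → f j = f j' →
      (π j' : ℕ) = π j + d := by
    intro d
    induction d with
    | zero => intro j j' hj _; rw [show j' = j from Fin.ext hj]; rfl
    | succ d ih =>
      intro j j' hj hf
      obtain ⟨k, hk⟩ : ∃ k : Fin n, (k : ℕ) = j + d := ⟨⟨j + d, by omega⟩, rfl⟩
      have h1 : f j ≤ f k := hfmono (Fin.le_def.mpr (by omega))
      have h2 : f k ≤ f j' := hfmono (Fin.le_def.mpr (by omega))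
      rw [← hf] at h2
      have h3 : f j = f k := le_antisymm h1 h2
      have h4 := ih j k hk h3
      have h5 : ¬ IsBreak π k := fun hb => by
        have h6 := hlt k j' (Fin.lt_def.mpr (by omega)) hb
        have h7 : F k = F j' := congrArg Fin.val (h3.symm.trans hf)
        omega
      have h6 : (π j' : ℕ) = π k + 1 := by
        by_contra hv
        exact h5 ⟨j', by omega, hv⟩
      omega
  -- the entries of a run are on the same side of an entry outside it
  have hside : ∀ j₁ j₂ j' : Fin n, f j₁ = f j₂ → f j' ≠ f j₁ → π j₁ < π j' → π j₂ < π j' := by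
    intro j₁ j₂ j' h12 hne hlt1
    by_contra hcon
    have hne2 : π j' ≠ π j₂ := fun he => hne ((congrArg f (π.injective he)).trans h12.symm)
    have hlt2 : (π j' : ℕ) < π j₂ := (not_lt.mp hcon).lt_of_ne hne2
    have hlt1' : (π j₁ : ℕ) < π j' := hlt1
    rcases le_or_gt j₂ j₁ with hle | hgt
    · have := hrun (j₁ - j₂) j₂ j₁ (by have : (j₂ : ℕ) ≤ j₁ := hle; omega) h12.symm
      omega
    · have hgt' : (j₁ : ℕ) < j₂ := hgt
      have h1 := hrun (j₂ - j₁) j₁ j₂ (by omega) h12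
      obtain ⟨k, hk⟩ : ∃ k : Fin n, (k : ℕ) = j₁ + (π j' - π j₁) :=
        ⟨⟨j₁ + (π j' - π j₁), by omega⟩, rfl⟩
      have h2 : f j₁ ≤ f k := hfmono (Fin.le_def.mpr (by omega))
      have h3 : f k ≤ f j₂ := hfmono (Fin.le_def.mpr (by omega))
      rw [← h12] at h3
      have h4 : f j₁ = f k := le_antisymm h2 h3
      have h5 := hrun _ j₁ k hk h4
      have h6 : k = j' := π.injective (Fin.ext (by omega))
      exact hne (h6 ▸ h4.symm)
  choose rep hrep using hsurj
  have hrepinj : Function.Injective rep := fun i i' h => by rw [← hrep i, ← hrep i', h]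
  obtain ⟨σ, hσ⟩ := exists_perm_of_key (fun i => π (rep i)) (π.injective.comp hrepinj)
  have hside' : ∀ j j', f j ≠ f j' → π j < π j' → π (rep (f j)) < π (rep (f j')) := by
    intro j j' hne hlt1
    have h1 : π (rep (f j)) < π j' := hside j _ j' (hrep _).symm (fun h => hne h.symm) hlt1
    by_contra hcon
    have hne' : rep (f j') ≠ rep (f j) := fun h => hne (hrepinj h).symm
    have h2 : π (rep (f j')) < π (rep (f j)) :=
      (not_lt.mp hcon).lt_of_ne fun h => hne' (π.injective h)
    have h3 := hside (rep (f j')) j' (rep (f j)) (hrep _) (by rw [hrep, hrep]; exact hne) h2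
    exact absurd h1 h3.not_gt
  have hlex : ∀ j j', π j < π j' ↔ σ (f j) < σ (f j') ∨ f j = f j' ∧ j < j' := by
    intro j j'
    rw [hσ]
    by_cases hff : f j = f j'
    · simp only [hff, lt_self_iff_false, true_and, false_or]
      rcases lt_trichotomy j j' with h1 | h1 | h1
      · have h1' : (j : ℕ) < j' := h1
        have := hrun (j' - j) j j' (by omega) hff
        exact ⟨fun _ => h1, fun _ => Fin.lt_def.mpr (by omega)⟩
      · rw [h1]
        simp
      · have h1' : (j' : ℕ) < j := h1
        have := hrun (j - j') j' j (by omega) hff.symm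
        exact ⟨fun h2 => absurd (Fin.lt_def.mp h2) (by omega), fun h2 => absurd h1 h2.not_gt⟩
    · simp only [hff, false_and, or_false]
      refine ⟨hside' j j' hff, fun h => ?_⟩
      by_contra hcon
      have hne : π j' ≠ π j := fun h => hff (congrArg f (π.injective h)).symm
      exact absurd h (hside' j' j (fun h => hff h.symm) ((not_lt.mp hcon).lt_of_ne hne)).not_gt
  refine ⟨l, σ, fun i => (Finset.univ.filter fun j => f j = i).card, f, rfl, ?_, fun i => ?_,
    hfmono, fun i => rfl, hlex⟩
  · intro i i' hii' hσi
    obtain ⟨e, e', hee', he, he'⟩ := hattain (n - 1) (by omega) i (by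
      rw [hlast]
      have := i'.2
      simp only [l] at this
      omega)
    have hfe : f e = i := Fin.ext he
    have hfe' : f e' = i' := Fin.ext (he'.trans hii'.symm)
    have hbreak : (π e' : ℕ) ≠ π e + 1 := fun hv => by
      have hsub : F e' ≤ F e := Finset.card_le_card fun u hu => by
        simp only [Finset.mem_filter, Finset.mem_univ, true_and] at hu ⊢
        refine ⟨hu.1, lt_of_le_of_ne (Fin.le_def.mpr ?_) ?_⟩
        · have : (u : ℕ) < e' := hu.2
          omega
        · rintro rfl
          obtain ⟨w, hw, hwv⟩ := hu.1
          have : w = e' := Fin.ext (hw.trans hee'.symm)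
          exact hwv (this ▸ hv)
      omega
    have hlt1 : (π e : ℕ) < π e' := (hlex e e').mpr (Or.inl (by
      rw [hfe, hfe']
      exact Fin.lt_def.mpr (by omega)))
    have hb : (π e : ℕ) + 1 < n := by omega
    obtain ⟨w, hw⟩ : ∃ w, (π w : ℕ) = π e + 1 := by
      obtain ⟨w, hw⟩ := π.surjective ⟨π e + 1, hb⟩
      exact ⟨w, by rw [hw]⟩
    have h1 := (hlex e w).mp (Fin.lt_def.mpr (by omega))
    have h2 := (hlex w e').mp (Fin.lt_def.mpr (by omega))
    rw [hfe] at h1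
    rw [hfe'] at h2
    rcases h1 with h1 | ⟨h1, h3⟩
    · rcases h2 with h2 | ⟨h2, h4⟩
      · rw [Fin.lt_def] at h1 h2
        omega
      · have : f w ≤ f e := hfmono (Fin.le_def.mpr (by rw [Fin.lt_def] at h4; omega))
        rw [h2, hfe, Fin.le_def] at this
        omega
    · have : f e' ≤ f w := hfmono (Fin.le_def.mpr (by rw [Fin.lt_def] at h3; omega))
      rw [hfe', ← h1, Fin.le_def] at this
      omega
  · exact Finset.card_pos.mpr ⟨rep i, by simp [hrep]⟩

end Inflation

/-! ### The counting polynomial -/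

section Counting

open Finset in
/-- The number of vectors with a given sum whose truncation at `c` is `τ`: only the coordinates
with `τ i = c` are free. -/
theorem card_truncated {l : ℕ} (c n : ℕ) (τ : Fin l → ℕ) (hτ : ∀ i, τ i ≤ c)
    (hn : ∑ i, τ i ≤ n) :
    ((piAntidiag univ n).filter fun t : Fin l → ℕ => ∀ i, min (t i) c = τ i).card =
      ((univ.filter fun i => τ i = c).card + (n - ∑ i, τ i) - 1).choose (n - ∑ i, τ i) := by
  rw [← card_finsuppAntidiag_nat_eq_choose]
  refine card_bij' (fun t _ => Finsupp.equivFunOnFinite.symm fun i => t i - τ i)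
    (fun u _ i => u i + τ i) ?_ ?_ ?_ ?_
  · intro t ht
    simp only [mem_filter, mem_piAntidiag, mem_univ, implies_true, and_true] at ht
    obtain ⟨hsum, hmin⟩ := ht
    have hle : ∀ i, τ i ≤ t i := fun i => by have := hmin i; omega
    have hne : ∀ i, t i - τ i ≠ 0 → τ i = c := fun i hi => by have := hmin i; omega
    rw [mem_finsuppAntidiag]
    constructor
    · have h1 : ∑ i ∈ univ.filter (fun i => τ i = c), (t i - τ i) = ∑ i, (t i - τ i) :=
        sum_subset (filter_subset _ _) fun i _ hi => by
          by_contra h0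
          exact hi (mem_filter.mpr ⟨mem_univ _, hne i h0⟩)
      have h2 : ∑ i, (t i - τ i) + ∑ i, τ i = n := by
        rw [← sum_add_distrib, ← hsum]
        exact sum_congr rfl fun i _ => Nat.sub_add_cancel (hle i)
      change ∑ i ∈ univ.filter (fun i => τ i = c), (t i - τ i) = _
      omega
    · intro i hi
      exact mem_filter.mpr ⟨mem_univ _, hne i (Finsupp.mem_support_iff.mp hi)⟩
  · intro u hu
    obtain ⟨hsum, hsupp⟩ := mem_finsuppAntidiag.mp hu
    have hzero : ∀ i, τ i ≠ c → u i = 0 := fun i hi => by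
      by_contra h0
      exact hi (mem_filter.mp (hsupp (Finsupp.mem_support_iff.mpr h0))).2
    simp only [mem_filter, mem_piAntidiag, mem_univ, implies_true, and_true]
    constructor
    · have h1 : ∑ i ∈ univ.filter (fun i => τ i = c), u i = ∑ i, u i :=
        sum_subset (filter_subset _ _) fun i _ hi => hzero i fun h => hi (by simp [h])
      change ∑ i ∈ univ.filter (fun i => τ i = c), u i = _ at hsum
      rw [sum_add_distrib]
      omega
    · intro i
      have := hτ i
      by_cases hi : τ i = c
      · omega
      · rw [hzero i hi]
        omega
  · intro t ht
    have hmin := (mem_filter.mp ht).2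
    funext i
    have := hmin i
    change t i - τ i + τ i = t i
    omega
  · intro u hu
    ext i
    change u i + τ i - τ i = u i
    omega

/-- A permutation `σ` together with the lengths of the runs in an inflation of it. -/
abbrev RunData : Type := Σ l : ℕ, Equiv.Perm (Fin l) × (Fin l → ℕ)

/-- The set of permutations in the class of size `n`. -/
abbrev shuffleClass (a b m n : ℕ) : Set (Equiv.Perm (Fin n)) :=
  Av n (partialShuffle a b ∪ {decreasing m})

theorem size_le_of_mem {a b m : ℕ} {ρ : SizedPerm} (hρ : ρ ∈ partialShuffle a b ∪ {decreasing m}) :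
    ρ.1 ≤ a + b + m := by
  rcases hρ with ⟨ρ, -, rfl⟩ | rfl
  · exact Nat.le_add_right _ _
  · exact Nat.le_add_left _ _

theorem mem_shuffleClass_of_min_le {a b m l n n' : ℕ} {σ : Equiv.Perm (Fin l)} {t t' : Fin l → ℕ}
    {π : Equiv.Perm (Fin n)} {π' : Equiv.Perm (Fin n')} {f : Fin n → Fin l} {f' : Fin n' → Fin l}
    (h : IsInflation σ t π f) (h' : IsInflation σ t' π' f')
    (hmin : ∀ i, min (t' i) (a + b + m) ≤ t i) (hπ : π ∈ shuffleClass a b m n) :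
    π' ∈ shuffleClass a b m n' :=
  fun ρ hρ hc => hπ ρ hρ (h'.contains_of_min_le h hmin (size_le_of_mem hρ) hc)

open Classical in
/-- The run data of those permutations in the class whose number of runs is within the bound of
`card_breaks_le` and whose runs have length at most `a + b + m`. By `exists_mem_truncatedData` these
are the truncations of the run data of all nonempty permutations in the class. -/
noncomputable def truncatedData (a b m : ℕ) : Finset RunData :=
  ((Finset.range ((3 * (a + b) + 2) * (m - 1) * (m - 1) + 2)).sigma fun _ =>
    Finset.univ ×ˢ Fintype.piFinset fun _ => Finset.range (a + b + m + 1)).filter fun d =>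
      RunFree d.2.1 ∧ (∀ i, 0 < d.2.2 i) ∧ ∃ (n : ℕ) (π : Equiv.Perm (Fin n))
        (f : Fin n → Fin d.1), IsInflation d.2.1 d.2.2 π f ∧ π ∈ shuffleClass a b m n

/-- The number of long runs in run data truncated at `c`. -/
def numLong (c : ℕ) (d : RunData) : ℕ := (Finset.univ.filter fun i => d.2.2 i = c).card

variable {a b m : ℕ}

open Classical in
theorem mem_truncatedData {d : RunData} : d ∈ truncatedData a b m ↔
    (d.1 ≤ (3 * (a + b) + 2) * (m - 1) * (m - 1) + 1 ∧ ∀ i, d.2.2 i ≤ a + b + m) ∧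
      RunFree d.2.1 ∧ (∀ i, 0 < d.2.2 i) ∧ ∃ (n : ℕ) (π : Equiv.Perm (Fin n))
        (f : Fin n → Fin d.1), IsInflation d.2.1 d.2.2 π f ∧ π ∈ shuffleClass a b m n := by
  rw [truncatedData, Finset.mem_filter]
  simp only [Finset.mem_sigma, Finset.mem_range, Finset.mem_product, Finset.mem_univ, true_and,
    Fintype.mem_piFinset, Nat.lt_succ_iff]

/-- The truncated run data of a permutation in the class. -/
theorem exists_mem_truncatedData (ha : 1 ≤ a) (hab : 2 ≤ a + b) (hm : 2 ≤ m) {n : ℕ} (hn : 0 < n)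
    {π : Equiv.Perm (Fin n)} (hπ : π ∈ shuffleClass a b m n) :
    ∃ (l : ℕ) (σ : Equiv.Perm (Fin l)) (t : Fin l → ℕ) (f : Fin n → Fin l), RunFree σ ∧
      (∀ i, 0 < t i) ∧ IsInflation σ t π f ∧
        (⟨l, σ, fun i => min (t i) (a + b + m)⟩ : RunData) ∈ truncatedData a b m := by
  obtain ⟨l, σ, t, f, hl, hσ, ht, h⟩ := exists_runFree_isInflation hn π
  refine ⟨l, σ, t, f, hσ, ht, h, ?_⟩
  obtain ⟨hL, hR, hD⟩ := (mem_Av_iff ha).mp hπ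
  have hK := card_breaks_le ha hab hm hL hR hD
  obtain ⟨π', f', h'⟩ := exists_isInflation σ (fun i => min (t i) (a + b + m)) rfl
  refine mem_truncatedData.mpr ⟨⟨by simp only; omega, fun i => min_le_right _ _⟩, hσ,
    fun i => lt_min (ht i) (by omega), _, π', f', h',
    mem_shuffleClass_of_min_le h h' (fun i => (min_le_left _ _).trans (min_le_left _ _)) hπ⟩

theorem ncard_shuffleClass (ha : 1 ≤ a) (hab : 2 ≤ a + b) (hm : 2 ≤ m) {n : ℕ} (hn : 0 < n) :
    (shuffleClass a b m n).ncard = ∑ d ∈ truncatedData a b m,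
      ((Finset.piAntidiag Finset.univ n).filter
        fun t : Fin d.1 → ℕ => ∀ i, min (t i) (a + b + m) = d.2.2 i).card := by
  classical
  rw [← Finset.card_sigma, Set.ncard_eq_toFinset_card']
  have hex : ∀ x : Σ d : RunData, (Fin d.1 → ℕ),
      x ∈ (truncatedData a b m).sigma (fun d => (Finset.piAntidiag Finset.univ n).filter
        fun t : Fin d.1 → ℕ => ∀ i, min (t i) (a + b + m) = d.2.2 i) →
      ∃ (π : Equiv.Perm (Fin n)) (f : Fin n → Fin x.1.1), IsInflation x.1.2.1 x.2 π f := by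
    intro x hx
    have h := (Finset.mem_filter.mp (Finset.mem_sigma.mp hx).2).1
    exact exists_isInflation _ _ (Finset.mem_piAntidiag.mp h).1
  symm
  refine Finset.card_bij (fun x hx => (hex x hx).choose) ?_ ?_ ?_
  · rintro ⟨d, t⟩ hx
    obtain ⟨f, hf⟩ := (hex ⟨d, t⟩ hx).choose_spec
    obtain ⟨hd, ht⟩ := Finset.mem_sigma.mp hx
    obtain ⟨-, -, -, n', π', f', h', hπ'⟩ := mem_truncatedData.mp hd
    rw [Set.mem_toFinset]
    exact mem_shuffleClass_of_min_le h' hf (fun i => ((Finset.mem_filter.mp ht).2 i).le) hπ'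
  · rintro ⟨⟨l, σ, τ⟩, t⟩ hx ⟨⟨l', σ', τ'⟩, t'⟩ hx' heq
    obtain ⟨f, hf⟩ := (hex _ hx).choose_spec
    obtain ⟨f', hf'⟩ := (hex _ hx').choose_spec
    rw [← heq] at hf'
    obtain ⟨hd, ht⟩ := Finset.mem_sigma.mp hx
    obtain ⟨hd', ht'⟩ := Finset.mem_sigma.mp hx'
    obtain ⟨-, hσ, hτ, -⟩ := mem_truncatedData.mp hd
    obtain ⟨-, hσ', hτ', -⟩ := mem_truncatedData.mp hd'
    have hmin := (Finset.mem_filter.mp ht).2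
    have hmin' := (Finset.mem_filter.mp ht').2
    dsimp only at hf hf' hσ hτ hσ' hτ' hmin hmin'
    have hdata := hf.data_unique hf' (fun i => by have := hτ i; have := hmin i; omega)
      (fun i => by have := hτ' i; have := hmin' i; omega) hσ hσ'
    obtain ⟨rfl, hh⟩ := Sigma.mk.inj_iff.mp hdata
    obtain ⟨rfl, rfl⟩ := Prod.mk.injEq .. ▸ eq_of_heq hh
    have : τ = τ' := funext fun i => (hmin i).symm.trans (hmin' i)
    rw [this]
  · intro π hπ
    rw [Set.mem_toFinset] at hπ
    obtain ⟨l, σ, t, f, hσ, ht, h, hmem⟩ := exists_mem_truncatedData ha hab hm hn hπ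
    have hx : (⟨⟨l, σ, fun i => min (t i) (a + b + m)⟩, t⟩ : Σ d : RunData, (Fin d.1 → ℕ)) ∈
        (truncatedData a b m).sigma (fun d => (Finset.piAntidiag Finset.univ n).filter
          fun t : Fin d.1 → ℕ => ∀ i, min (t i) (a + b + m) = d.2.2 i) := by
      refine Finset.mem_sigma.mpr ⟨hmem, Finset.mem_filter.mpr ⟨?_, fun i => rfl⟩⟩
      exact Finset.mem_piAntidiag.mpr ⟨h.sum_eq, fun i _ => Finset.mem_univ i⟩
    obtain ⟨f', hf'⟩ := (hex _ hx).choose_spec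
    exact ⟨_, hx, hf'.perm_unique h⟩

theorem numLong_le (ha : 1 ≤ a) (hab : 2 ≤ a + b) (hm : 2 ≤ m) {d : RunData}
    (hd : d ∈ truncatedData a b m) : numLong (a + b + m) d ≤ (a + b - 2) * (m - 2) + 1 := by
  obtain ⟨-, hσ, hτ, n, π, f, h, hπ⟩ := mem_truncatedData.mp hd
  obtain ⟨hL, hR, hD⟩ := (mem_Av_iff ha).mp hπ
  have hex : ∀ i : Fin d.1, ∃ e : Fin n, d.2.2 i = a + b + m →
      f e = i ∧ IsLongRunEnd (a + b + m) π e := by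
    intro i
    by_cases hi : d.2.2 i = a + b + m
    · obtain ⟨e, he⟩ := h.exists_isLongRunEnd hτ hσ i hi.ge
      exact ⟨e, fun _ => he⟩
    · exact ⟨(h.surjective hτ i).choose, fun h => absurd h hi⟩
  choose e he using hex
  have hinj : Set.InjOn e (Finset.univ.filter fun i => d.2.2 i = a + b + m) := by
    intro i hi j hj hij
    have h1 := (he i (Finset.mem_filter.mp hi).2).1
    have h2 := (he j (Finset.mem_filter.mp hj).2).1
    rw [← h1, ← h2, hij]
  rw [numLong, ← Finset.card_image_of_injOn hinj]
  refine card_longRunEnds_le (c := a + b + m) ha hab hm (Nat.le_add_right _ _) hL hR hD _ fun x hx => ?_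
  obtain ⟨i, hi, rfl⟩ := Finset.mem_image.mp hx
  exact (he i (Finset.mem_filter.mp hi).2).2

theorem exists_numLong_eq (ha : 1 ≤ a) (hab : 2 ≤ a + b) (hm : 2 ≤ m) :
    ∃ d ∈ truncatedData a b m, numLong (a + b + m) d = (a + b - 2) * (m - 2) + 1 := by
  obtain ⟨n, π, hL, hR, hD, E, hE, hlong⟩ :=
    exists_perm_with_long_runs ha hab hm (c := a + b + m) (by omega)
  obtain ⟨e₀, -⟩ : E.Nonempty := Finset.card_pos.mp (by omega)
  obtain ⟨l, σ, t, f, hσ, ht, h, hmem⟩ :=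
    exists_mem_truncatedData ha hab hm e₀.pos ((mem_Av_iff ha).mpr ⟨hL, hR, hD⟩)
  refine ⟨_, hmem, (numLong_le ha hab hm hmem).antisymm ?_⟩
  rw [← hE, numLong]
  refine Finset.card_le_card_of_injOn f (fun e he => ?_)
    (h.injOn_isLongRunEnd.mono fun e he => hlong e he)
  have := h.le_of_isLongRunEnd ht hσ (hlong e he)
  simpa using this

open Polynomial in
/-- The contribution of the truncated run data `d` to the polynomial: the number of vectors of run
lengths with sum `n` and truncation `d`, which is eventually `0` if there is no long run. -/
noncomputable def countPoly (c : ℕ) (d : RunData) : ℚ[X] :=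
  if numLong c d = 0 then 0 else preHilbertPoly ℚ (numLong c d - 1) (∑ i, d.2.2 i)

theorem eval_countPoly {c n : ℕ} {d : RunData} (hd : ∀ i, d.2.2 i ≤ c) (hn : ∑ i, d.2.2 i < n) :
    (countPoly c d).eval (n : ℚ) = ((Finset.piAntidiag Finset.univ n).filter
      fun t : Fin d.1 → ℕ => ∀ i, min (t i) c = d.2.2 i).card := by
  rw [card_truncated c n _ hd hn.le, countPoly]
  change _ = (((numLong c d + (n - ∑ i, d.2.2 i) - 1).choose (n - ∑ i, d.2.2 i) : ℕ) : ℚ)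
  split_ifs with h0
  · rw [h0, Nat.choose_eq_zero_of_lt (by omega), Polynomial.eval_zero, Nat.cast_zero]
  · rw [Polynomial.preHilbertPoly_eq_choose_sub_add ℚ _ hn.le]
    congr 1
    rw [show numLong c d + (n - ∑ i, d.2.2 i) - 1 =
      n - ∑ i, d.2.2 i + (numLong c d - 1) by omega]
    exact Nat.choose_symm_of_eq_add rfl |>.symm

theorem coeff_countPoly_nonneg {c D : ℕ} {d : RunData} (h : numLong c d ≤ D + 1) :
    0 ≤ (countPoly c d).coeff D := by
  rw [countPoly]
  split_ifs with h0
  · simp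
  · rcases (show numLong c d - 1 ≤ D by omega).lt_or_eq with hlt | heq
    · rw [Polynomial.coeff_eq_zero_of_natDegree_lt]
      rwa [Polynomial.natDegree_preHilbertPoly]
    · rw [heq, Polynomial.coeff_preHilbertPoly_self]
      positivity

theorem coeff_countPoly_pos {c D : ℕ} {d : RunData} (h : numLong c d = D + 1) :
    0 < (countPoly c d).coeff D := by
  rw [countPoly, if_neg (by omega), h, Nat.add_sub_cancel, Polynomial.coeff_preHilbertPoly_self]
  positivity

theorem degree_countPoly_le {c D : ℕ} {d : RunData} (h : numLong c d ≤ D + 1) :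
    (countPoly c d).degree ≤ D := by
  rw [countPoly]
  split_ifs with h0
  · simp
  · refine Polynomial.degree_le_of_natDegree_le ?_
    rw [Polynomial.natDegree_preHilbertPoly]
    omega

end Counting

end PermPattern

theorem theorem3 (a b m : ℕ) (ha : 1 ≤ a) (hab : 2 ≤ a + b) (hm : 2 ≤ m) :
    ∃ p : Polynomial ℚ,
      p.degree = (((a + b - 2) * (m - 2) : ℕ) : WithBot ℕ) ∧
      ∃ N : ℕ, ∀ n : ℕ, N ≤ n →
        ((PermPattern.Av n
            (PermPattern.partialShuffle a b ∪ {PermPattern.decreasing m})).ncard : ℚ) =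
          p.eval (n : ℚ) := by
  open PermPattern in
  refine ⟨∑ d ∈ truncatedData a b m, countPoly (a + b + m) d, ?_,
    ∑ d ∈ truncatedData a b m, (∑ i, d.2.2 i) + 1, fun n hn => ?_⟩
  · refine Polynomial.degree_eq_of_le_of_coeff_ne_zero ?_ (ne_of_gt ?_)
    · exact (Polynomial.degree_sum_le _ _).trans
        (Finset.sup_le fun d hd => degree_countPoly_le (numLong_le ha hab hm hd))
    · obtain ⟨d, hd, hlong⟩ := exists_numLong_eq ha hab hm
      rw [Polynomial.finsetSum_coeff]
      exact Finset.sum_pos' (fun d hd => coeff_countPoly_nonneg (numLong_le ha hab hm hd))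
        ⟨d, hd, coeff_countPoly_pos hlong⟩
  · rw [ncard_shuffleClass ha hab hm (by omega), Polynomial.eval_finsetSum, Nat.cast_sum]
    refine Finset.sum_congr rfl fun d hd => (eval_countPoly (mem_truncatedData.mp hd).1.2 ?_).symm
    exact Nat.lt_of_succ_le ((Nat.succ_le_succ (Finset.single_le_sum
      (f := fun d : RunData => ∑ i, d.2.2 i) (fun _ _ => Nat.zero_le _) hd)).trans hn)
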